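/- Fix disjoint countably infinite sets of constants, labelled nulls and variables. An instance is a possibly infinite set of relational atoms over constants and nulls; a database is a finite instance. A conjunctive query (CQ) is $q(\bar x)=\exists\bar y\,(R_1(\bar v_1)\wedge\dots\wedge R_m(\bar v_m))$ with atoms over constants and variables; $q(I)$ is the set of tuples $h(\bar x)$ over all homomorphisms $h$ from $q$ to the instance $I$ that are the identity on constants. A CQ is acyclic if there are a tree $T$ and a labelling of its nodes by atoms of $q$ such that every atom of $q$ labels some node and, for each variable $x$ of $q$, the nodes whose label contains $x$ form a connected subset of $T$. A tuple-generating dependency (tgd) $\forall\bar x\forall\bar y\,(\phi(\bar x,\bar y)\rightarrow\exists\bar z\,\psi(\bar x,\bar z))$, with $\phi,\psi$ conjunctions of atoms over constants and variables, is guarded if some atom of $\phi$ contains all variables of $\phi$. A CQ $q$ is semantically acyclic under a finite set $\Sigma$ of tgds if there is an acyclic CQ $q'$ with $q(I)=q'(I)$ for every (finite or infinite) instance $I$ satisfying $\Sigma$. Theorem. The following promise problem $\mathsf{SemAcEval}(\mathbb G)$ is solvable in polynomial time, measured in the length of the whole input. Input: a finite set $\Sigma$ of guarded tgds, a CQ $q$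 that is semantically acyclic under $\Sigma$, a database $D$ with $D\models\Sigma$, and a tuple $\bar t$ of elements of $D$. Question: is $\bar t\in q(D)$? -/

import Mathlib

namespace SemAc

/-! ### Atoms, instances, conjunctive queries -/

/-- The elements of instances: constants and labelled nulls, two disjoint countably infinite sets. -/
inductive Value where
  | const (n : ℕ)
  | null (n : ℕ)

/-- The terms of queries and dependencies: constants and variables. -/
inductive QTerm where
  | const (n : ℕ)
  | var (n : ℕ)

/-- An atom `R(v₁, …, vₙ)` over the elements of `α`. A relation symbol is the pair of its name
`rel` and its arity `args.length`, so the atoms over any relational schema are found here. -/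
structure Atom (α : Type) where
  rel : ℕ
  args : List α

/-- Rename the elements of an atom. -/
def Atom.map {α β : Type} (f : α → β) (a : Atom α) : Atom β :=
  ⟨a.rel, a.args.map f⟩

/-- An instance: a possibly infinite set of atoms over constants and nulls. -/
abbrev Inst : Type := Set (Atom Value)

/-- A conjunctive query: the tuple of its free variables and the list of atoms of its body; every
other variable is existentially quantified. -/
structure CQ where
  free : List ℕ
  body : List (Atom QTerm)

/-- The extension of an assignment of the variables to all terms, the identity on constants. -/
def assign (h : ℕ → Value) : QTerm → Value
  | .const c => .const c
  | .var x => h x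

/-- `h` maps every atom of the list into the instance `I`. -/
def IsHom (h : ℕ → Value) (body : List (Atom QTerm)) (I : Inst) : Prop :=
  ∀ a ∈ body, a.map (assign h) ∈ I

/-- The evaluation `q(I)`: all tuples `h(x̄)`, for `h` a homomorphism from `q` to `I`. -/
def CQ.eval (q : CQ) (I : Inst) : Set (List Value) :=
  {t | ∃ h : ℕ → Value, IsHom h q.body I ∧ q.free.map h = t}

/-! ### Acyclicity -/

/-- An instance is acyclic if it admits a join tree. -/
def AcyclicInst (I : Inst) : Prop :=
  ∃ (V : Type) (T : SimpleGraph V) (lab : V → Atom Value),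
    T.IsTree ∧
    (∀ v, lab v ∈ I) ∧
    (∀ a ∈ I, ∃ v, lab v = a) ∧
    ∀ n : ℕ, (∃ a ∈ I, Value.null n ∈ a.args) →
      (T.induce {v | Value.null n ∈ (lab v).args}).Connected

/-- A conjunctive query is acyclic if the instance of its atoms, with the variables replaced by
distinct nulls, is acyclic. -/
def CQ.Acyclic (q : CQ) : Prop :=
  AcyclicInst {a | ∃ b ∈ q.body, a = b.map (assign Value.null)}

/-! ### Tuple-generating dependencies -/

/-- A tuple-generating dependency `φ(x̄, ȳ) → ∃ z̄ ψ(x̄, z̄)`: `body` is `φ`, `head` is `ψ`. -/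
structure TGD where
  body : List (Atom QTerm)
  head : List (Atom QTerm)

/-- The variable of a term, if it is one. -/
def QTerm.vars : QTerm → List ℕ
  | .const _ => []
  | .var x => [x]

/-- The variables of an atom. -/
def Atom.vars (a : Atom QTerm) : List ℕ := a.args.flatMap QTerm.vars

/-- The variables of a conjunction of atoms. -/
def conjVars (l : List (Atom QTerm)) : List ℕ := l.flatMap Atom.vars

/-- The tuple `x̄` of the variables that the body shares with the head. -/
def TGD.frontier (τ : TGD) : List ℕ :=
  (conjVars τ.body).filter (fun x => decide (x ∈ conjVars τ.head))

/-- `I` satisfies the tgd: `q_φ(I) ⊆ q_ψ(I)` for `q_φ(x̄) = ∃ ȳ φ` and `q_ψ(x̄) = ∃ z̄ ψ`. -/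
def TGD.Sat (τ : TGD) (I : Inst) : Prop :=
  CQ.eval ⟨τ.frontier, τ.body⟩ I ⊆ CQ.eval ⟨τ.frontier, τ.head⟩ I

/-- `I ⊨ Σ`. -/
def Models (I : Inst) (S : Set TGD) : Prop := ∀ τ ∈ S, τ.Sat I

/-- A tgd is guarded if some atom of its body contains all the variables of the body. -/
def TGD.Guarded (τ : TGD) : Prop :=
  ∃ g ∈ τ.body, ∀ x ∈ conjVars τ.body, x ∈ g.vars

/-- The class of all sets of guarded tgds. -/
def GuardedSets : Set (Set TGD) := {S | ∀ τ ∈ S, τ.Guarded}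

/-- `q ⊆_Σ q'`, over all instances, finite or infinite, that satisfy `Σ`. -/
def ContainedUnder (S : Set TGD) (q q' : CQ) : Prop :=
  ∀ I : Inst, Models I S → q.eval I ⊆ q'.eval I

/-- `q ≡_Σ q'`. -/
def EquivUnder (S : Set TGD) (q q' : CQ) : Prop :=
  ContainedUnder S q q' ∧ ContainedUnder S q' q

/-- `q` is semantically acyclic under `Σ`. -/
def SemAcyclic (S : Set TGD) (q : CQ) : Prop :=
  ∃ q' : CQ, q'.Acyclic ∧ EquivUnder S q q'

/-! ### Encodings as words over a finite alphabet -/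

open Computability (Γ')

/-- A natural number in binary, closed by a comma. -/
def encNat (n : ℕ) : List Γ' := (Computability.encodeNat n).map Γ'.bit ++ [Γ'.comma]

/-- A list, as the bracketed concatenation of the encodings of its members. -/
def encList {α : Type} (e : α → List Γ') (l : List α) : List Γ' :=
  Γ'.bra :: (l.flatMap e ++ [Γ'.ket])

def encValue : Value → List Γ'
  | .const n => Γ'.bit false :: encNat n
  | .null n => Γ'.bit true :: encNat n

def encTerm : QTerm → List Γ'
  | .const n => Γ'.bit false :: encNat n
  | .var n => Γ'.bit true :: encNat n

def encAtom {α : Type} (e : α → List Γ') (a : Atom α) : List Γ' :=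
  encNat a.rel ++ encList e a.args

def encTGD (τ : TGD) : List Γ' :=
  encList (encAtom encTerm) τ.body ++ encList (encAtom encTerm) τ.head

def encCQ (q : CQ) : List Γ' :=
  encList encNat q.free ++ encList (encAtom encTerm) q.body

/-- An input: a finite set of tgds, a query, a database (a finite instance) and a tuple. The finite
sets are presented by lists, in any order. -/
structure Input where
  tgds : List TGD
  query : CQ
  db : List (Atom Value)
  tuple : List Value

/-- The set of tgds of an input. -/
def Input.tgdSet (x : Input) : Set TGD := {τ | τ ∈ x.tgds}

/-- The database of an input, as an instance. -/
def Input.inst (x : Input) : Inst := {a | a ∈ x.db}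

def encInput (x : Input) : List Γ' :=
  encList encTGD x.tgds ++ (encCQ x.query ++
    (encList (encAtom encValue) x.db ++ encList encValue x.tuple))

/-- `e` is uniquely decodable from the left. -/
def SelfDelim {α : Type} (e : α → List Γ') : Prop :=
  ∀ a b s t, e a ++ s = e b ++ t → a = b ∧ s = t

/-- No code word begins with the closing bracket (or is empty). -/
def NoKet {α : Type} (e : α → List Γ') : Prop :=
  ∀ a, ∃ c l, e a = c :: l ∧ c ≠ Γ'.ket

theorem selfDelim_encNat : SelfDelim encNat := by
  have key : ∀ (l m : List Bool) (s t : List Γ'),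
      l.map Γ'.bit ++ Γ'.comma :: s = m.map Γ'.bit ++ Γ'.comma :: t → l = m ∧ s = t := by
    intro l
    induction l with
    | nil => intro m s t h; cases m <;> simp_all
    | cons b l ih =>
      intro m s t h
      cases m with
      | nil => simp at h
      | cons c m =>
        simp only [List.map_cons, List.cons_append, List.cons.injEq, Γ'.bit.injEq] at h
        obtain ⟨h1, h2⟩ := ih m s t h.2
        exact ⟨by rw [h.1, h1], h2⟩
  intro a b s t h
  obtain ⟨h1, h2⟩ := key _ _ s t (by simpa [encNat] using h)
  exact ⟨by simpa using congrArg Computability.decodeNat h1, h2⟩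

theorem noKet_encNat : NoKet encNat := by
  intro n
  unfold encNat
  cases Computability.encodeNat n <;> simp

theorem selfDelim_encList {α : Type} {e : α → List Γ'} (he : SelfDelim e) (hk : NoKet e) :
    SelfDelim (encList e) := by
  have key : ∀ (l m : List α) (s t : List Γ'),
      l.flatMap e ++ Γ'.ket :: s = m.flatMap e ++ Γ'.ket :: t → l = m ∧ s = t := by
    intro l
    induction l with
    | nil =>
      intro m s t h
      cases m with
      | nil => simp_all
      | cons b m => obtain ⟨c, r, hc, hne⟩ := hk b; simp [hc] at h; exact absurd h.1.symm hne
    | cons a l ih =>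
      intro m s t h
      cases m with
      | nil => obtain ⟨c, r, hc, hne⟩ := hk a; simp [hc] at h; exact absurd h.1 hne
      | cons b m =>
        simp only [List.flatMap_cons, List.append_assoc] at h
        obtain ⟨h1, h2⟩ := he _ _ _ _ h
        obtain ⟨h3, h4⟩ := ih m s t h2
        exact ⟨by rw [h1, h3], h4⟩
  intro a b s t h
  exact key a b s t (by simpa [encList] using h)

theorem noKet_encList {α : Type} (e : α → List Γ') : NoKet (encList e) :=
  fun _ => ⟨_, _, rfl, by simp⟩

theorem selfDelim_encValue : SelfDelim encValue := by
  intro a b s t h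
  cases a <;> cases b <;> simp [encValue] at h ⊢ <;> exact selfDelim_encNat _ _ _ _ h

theorem noKet_encValue : NoKet encValue := by
  intro a; cases a <;> simp [encValue]

theorem selfDelim_encTerm : SelfDelim encTerm := by
  intro a b s t h
  cases a <;> cases b <;> simp [encTerm] at h ⊢ <;> exact selfDelim_encNat _ _ _ _ h

theorem noKet_encTerm : NoKet encTerm := by
  intro a; cases a <;> simp [encTerm]

theorem selfDelim_encAtom {α : Type} {e : α → List Γ'} (he : SelfDelim e) (hk : NoKet e) :
    SelfDelim (encAtom e) := by
  rintro ⟨r, u⟩ ⟨r', u'⟩ s t h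
  simp only [encAtom, List.append_assoc] at h
  obtain ⟨rfl, h2⟩ := selfDelim_encNat _ _ _ _ h
  obtain ⟨rfl, h3⟩ := selfDelim_encList he hk _ _ _ _ h2
  exact ⟨rfl, h3⟩

theorem noKet_encAtom {α : Type} (e : α → List Γ') : NoKet (encAtom e) := by
  intro a
  obtain ⟨c, l, h, hc⟩ := noKet_encNat a.rel
  exact ⟨c, l ++ encList e a.args, by simp [encAtom, h], hc⟩

theorem selfDelim_encTGD : SelfDelim encTGD := by
  rintro ⟨b, d⟩ ⟨b', d'⟩ s t h
  have hl := selfDelim_encList (selfDelim_encAtom selfDelim_encTerm noKet_encTerm)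
    (noKet_encAtom encTerm)
  simp only [encTGD, List.append_assoc] at h
  obtain ⟨rfl, h2⟩ := hl _ _ _ _ h
  obtain ⟨rfl, h3⟩ := hl _ _ _ _ h2
  exact ⟨rfl, h3⟩

theorem noKet_encTGD : NoKet encTGD := fun _ => ⟨_, _, rfl, by simp⟩

theorem selfDelim_encCQ : SelfDelim encCQ := by
  rintro ⟨b, d⟩ ⟨b', d'⟩ s t h
  simp only [encCQ, List.append_assoc] at h
  obtain ⟨rfl, h2⟩ := selfDelim_encList selfDelim_encNat noKet_encNat _ _ _ _ h
  obtain ⟨rfl, h3⟩ := selfDelim_encList (selfDelim_encAtom selfDelim_encTerm noKet_encTerm)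
    (noKet_encAtom encTerm) _ _ _ _ h2
  exact ⟨rfl, h3⟩

theorem encInput_injective : Function.Injective encInput := by
  rintro ⟨S, q, D, t⟩ ⟨S', q', D', t'⟩ h
  simp only [encInput] at h
  obtain ⟨rfl, h1⟩ := selfDelim_encList selfDelim_encTGD noKet_encTGD _ _ _ _ h
  obtain ⟨rfl, h2⟩ := selfDelim_encCQ _ _ _ _ h1
  obtain ⟨rfl, h3⟩ := selfDelim_encList (selfDelim_encAtom selfDelim_encValue noKet_encValue)
    (noKet_encAtom encValue) _ _ _ _ h2
  obtain ⟨rfl, -⟩ := selfDelim_encList selfDelim_encValue noKet_encValue _ _ [] []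
    (by simpa using h3)
  rfl

/-- The binary encoding of inputs as words over the finite alphabet `Γ'`. -/
noncomputable def inputEncoding : Computability.Encoding Input Γ' where
  encode := encInput
  decode := Function.partialInv encInput
  decode_encode := Function.partialInv_left encInput_injective

/-! ### The evaluation problem -/

/-- A promise problem over `α`, read through an encoding by words over a finite alphabet, is in
polynomial time if some Turing machine (with several stacks) gives the right yes/no answer on every
input that keeps the promise, within a number of steps polynomial in the length of its encoding. -/
def PromiseInPolyTime {α Γ : Type} [Fintype Γ] (e : Computability.Encoding α Γ)
    (promise yes : α → Prop) : Prop :=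
  open scoped Classical in
  Nonempty (Turing.TM2ComputableInPolyTime
    (fun x : {x : α // promise x} => e.encode x.1) Computability.encodeBool
    (fun x => decide (yes x.1)))

/-- The promise of the evaluation problem for a class `C` of sets of tgds: `Σ ∈ C`, the query is
semantically acyclic under `Σ`, `D ⊨ Σ`, and the tuple consists of elements of `D`. -/
def SemAcEvalPromise (C : Set (Set TGD)) (x : Input) : Prop :=
  x.tgdSet ∈ C ∧ SemAcyclic x.tgdSet x.query ∧ Models x.inst x.tgdSet ∧
    ∀ v ∈ x.tuple, ∃ a ∈ x.inst, v ∈ a.args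

/-- The question of the evaluation problem: does the tuple belong to `q(D)`? -/
def SemAcEvalYes (x : Input) : Prop := x.tuple ∈ x.query.eval x.inst

end SemAc

/-! The algorithm looks neither at the tgds nor for an acyclic equivalent of the query. For every
atom of `q` it tabulates the assignments that map the atom onto a fact of `D` and respect the answer
tuple. It then keeps deleting assignments for which some atom of `q` has no remaining assignment
agreeing on the common variables. It accepts if the tuple fits the free variables and every atom
keeps an assignment (`Input.accepts`). A homomorphism that witnesses the answer restricts to
assignments that support each other and so are never deleted (`Input.accepts_of_yes`).

The converse, `mem_eval_of_local`, is the core. The surviving assignments form a finite index set,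
each index belonging to one atom of `q`. They define an instance `productInst`: each atom `a` has a
component, a product of copies of `D` over the indices of `a`, and the components are glued along
the constants and the common variables of `q`. Three facts about it are needed. (1) It satisfies the
tgds (`models_productInst`). A guard forces the image of a tgd body into one component; the
projections to the indices of that component are matches in `D`; the head witnesses found there
combine into elements of the product. (2) `q` holds in it, each variable being mapped to itself
(`isHom_productInst`). By (1), the acyclic query `q'` equivalent to `q` then holds in it as well.
(3) An acyclic query that maps to it also maps to `D` (`CQ.Acyclic.exists_isHom`). Each node of the
join tree lands in a component; indices are chosen along the tree so that neighbours agree on common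
elements, and connectedness makes the projected values well defined. Hence the tuple lies in
`q'(D)`, which equals `q(D)` because `D` is a model of the tgds. The product is in general infinite,
which is harmless since equivalence is required over all instances.

The running time is established on an actual stack machine. Structured programs over three stacks
are compiled to `TM2` step for step (`Run.reachIn`). Data are self-delimiting words on a stack
(`Item`), and `Poly` collects the functions that a program computes in place on the top item in
polynomial time. `Poly` is closed under composition, pairing, branching and folds with bounded
intermediate results, which suffices to build `Input.accepts`. -/

namespace SemAc

open Computability (Γ')
open Turing

/-! ### Structured stack programs and their cost -/

/-- The three working stacks. -/
inductive Stk where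
  | m | a | b
  deriving DecidableEq

instance : Fintype Stk := ⟨{.m, .a, .b}, fun k => by cases k <;> simp⟩

/-- The finite memory: the last symbol read and a flag. -/
abbrev Reg : Type := Option Γ' × Bool

/-- The contents of the working stacks. -/
structure Mem where
  m : List Γ'
  a : List Γ'
  b : List Γ'

def Mem.get (s : Mem) : Stk → List Γ'
  | .m => s.m
  | .a => s.a
  | .b => s.b

def Mem.set (s : Mem) (k : Stk) (l : List Γ') : Mem :=
  match k with
  | .m => { s with m := l }
  | .a => { s with a := l }
  | .b => { s with b := l }

/-- A state of a stack program. -/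
structure St where
  r : Reg
  mem : Mem

/-- Elementary instructions. -/
inductive Op where
  | push (k : Stk) (f : Reg → Γ')
  | pop (k : Stk) (f : Reg → Option Γ' → Reg)
  | peek (k : Stk) (f : Reg → Option Γ' → Reg)
  | load (f : Reg → Reg)

def Op.exec : Op → St → St
  | .push k f, s => ⟨s.r, s.mem.set k (f s.r :: s.mem.get k)⟩
  | .pop k f, s => ⟨f s.r (s.mem.get k).head?, s.mem.set k (s.mem.get k).tail⟩
  | .peek k f, s => ⟨f s.r (s.mem.get k).head?, s.mem⟩
  | .load f, s => ⟨f s.r, s.mem⟩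

/-- Structured programs over the three stacks. -/
inductive Cmd where
  | op (o : Op)
  | seq (c d : Cmd)
  | ite (p : Reg → Bool) (c d : Cmd)
  | loop (p : Reg → Bool) (c : Cmd)

/-- `Run c s t n`: the program `c` takes the state `s` to the state `t` in `n` steps. -/
inductive Run : Cmd → St → St → ℕ → Prop
  | op (o s) : Run (.op o) s (o.exec s) 1
  | seq {c d s t u n k} : Run c s t n → Run d t u k → Run (.seq c d) s u (n + k)
  | ite_true {p c d s t n} : p s.r = true → Run c s t n → Run (.ite p c d) s t (1 + n)
  | ite_false {p c d s t n} : p s.r = false → Run d s t n → Run (.ite p c d) s t (1 + n)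
  | loop_false {p c s} : p s.r = false → Run (.loop p c) s s 1
  | loop_true {p c s t u n k} : p s.r = true → Run c s t n → Run (.loop p c) t u k →
      Run (.loop p c) s u (1 + (n + k))

/-! ### Compilation to stack machines -/

/-- The program points of a program. -/
def Lab : Cmd → Type
  | .op _ => Unit
  | .seq c d => Lab c ⊕ Lab d
  | .ite _ c d => Option (Lab c ⊕ Lab d)
  | .loop _ c => Option (Lab c)

instance finiteLab : (c : Cmd) → Finite (Lab c)
  | .op _ => inferInstanceAs (Finite Unit)
  | .seq c d => by
      have := finiteLab c; have := finiteLab d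
      exact inferInstanceAs (Finite (Lab c ⊕ Lab d))
  | .ite _ c d => by
      have := finiteLab c; have := finiteLab d
      exact inferInstanceAs (Finite (Option (Lab c ⊕ Lab d)))
  | .loop _ c => by
      have := finiteLab c
      exact inferInstanceAs (Finite (Option (Lab c)))

def entry : (c : Cmd) → Lab c
  | .op _ => ()
  | .seq c _ => Sum.inl (entry c)
  | .ite _ _ _ => none
  | .loop _ _ => none

/-- The alphabets of the machine: the working stacks and an output stack of booleans. -/
def Alph : Option Stk → Type
  | none => Bool
  | some _ => Γ'

def Op.stmt {L : Type} (q : TM2.Stmt Alph L Reg) : Op → TM2.Stmt Alph L Reg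
  | .push k f => .push (some k) f q
  | .pop k f => .pop (some k) f q
  | .peek k f => .peek (some k) f q
  | .load f => .load f q

/-- The code of a program whose points are placed by `e` and that continues at `x`. -/
def code {L : Type} : (c : Cmd) → (Lab c → L) → L → Lab c → TM2.Stmt Alph L Reg
  | .op o, _, x, _ => o.stmt (.goto fun _ => x)
  | .seq c d, e, x, l => match l with
    | .inl l => code c (fun i => e (.inl i)) (e (.inr (entry d))) l
    | .inr l => code d (fun i => e (.inr i)) x l
  | .ite p c d, e, x, l => match l with
    | none => .branch p (.goto fun _ => e (some (.inl (entry c))))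
        (.goto fun _ => e (some (.inr (entry d))))
    | some (.inl l) => code c (fun i => e (some (.inl i))) x l
    | some (.inr l) => code d (fun i => e (some (.inr i))) x l
  | .loop p c, e, x, l => match l with
    | none => .branch p (.goto fun _ => e (some (entry c))) (.goto fun _ => x)
    -- The body of a loop continues at the test of the loop.
    | some l => code c (fun i => e (some i)) (e none) l

/-- The stacks of the machine with an empty output stack. -/
def Mem.stk (s : Mem) : (k : Option Stk) → List (Alph k)
  | none => []
  | some k => s.get k

def cfg {L : Type} (l : L) (s : St) : TM2.Cfg Alph L Reg := ⟨some l, s.r, s.mem.stk⟩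

theorem Mem.update_stk (s : Mem) (k : Stk) (l : List (Alph (some k))) :
    Function.update s.stk (some k) l = (s.set k l).stk := by
  funext k'
  rcases eq_or_ne k' (some k) with rfl | h
  · refine (Function.update_self (some k) l s.stk).trans ?_
    cases k <;> rfl
  · refine (Function.update_of_ne h l s.stk).trans ?_
    rcases k' with _ | k'
    · rfl
    · cases k <;> cases k' <;> first | rfl | exact absurd rfl h

theorem Op.stepAux_stmt {L : Type} (o : Op) (s : St) (x : L) :
    TM2.stepAux (o.stmt (.goto fun _ => x)) s.r s.mem.stk = cfg x (o.exec s) := by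
  cases o with
  | push k f => exact congrArg _ (s.mem.update_stk k (f s.r :: s.mem.get k))
  | pop k f => exact congrArg _ (s.mem.update_stk k (s.mem.get k).tail)
  | peek k f => rfl
  | load f => rfl

/-- The machine reaches `d` from `c` in exactly `n` steps. -/
def ReachIn {L : Type} (M : L → TM2.Stmt Alph L Reg) (n : ℕ) (c d : TM2.Cfg Alph L Reg) : Prop :=
  (flip bind (TM2.step M))^[n] (some c) = some d

theorem ReachIn.trans {L : Type} {M : L → TM2.Stmt Alph L Reg} {n k : ℕ}
    {c d f : TM2.Cfg Alph L Reg} (h : ReachIn M n c d) (h' : ReachIn M k d f) :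
    ReachIn M (n + k) c f := by
  unfold ReachIn at *
  rw [add_comm, Function.iterate_add_apply, h, h']

theorem ReachIn.one {L : Type} {M : L → TM2.Stmt Alph L Reg} {l : L} {s : St}
    {d : TM2.Cfg Alph L Reg} (h : TM2.stepAux (M l) s.r s.mem.stk = d) :
    ReachIn M 1 (cfg l s) d := by
  subst h; rfl

/-- The ambient machine, the placement of the program points and the exit are arbitrary, so that the
induction hypotheses apply to subprograms sitting inside a larger program. -/
theorem Run.reachIn {c : Cmd} {s t : St} {n : ℕ} (h : Run c s t n) :
    ∀ {L : Type} (M : L → TM2.Stmt Alph L Reg) (e : Lab c → L) (x : L),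
      (∀ l, M (e l) = code c e x l) → ReachIn M n (cfg (e (entry c)) s) (cfg x t) := by
  induction h with
  | op o s =>
    intro L M e x hM
    exact ReachIn.one (by rw [hM]; exact o.stepAux_stmt s x)
  | @seq c d s t u n k _ _ ih₁ ih₂ =>
    intro L M e x hM
    exact (ih₁ M (fun i => e (.inl i)) (e (.inr (entry d))) fun l => hM (.inl l)).trans
      (ih₂ M (fun i => e (.inr i)) x fun l => hM (.inr l))
  | @ite_true p c d s t n hp _ ih =>
    intro L M e x hM
    refine ReachIn.trans (ReachIn.one ?_)
      (ih M (fun i => e (some (.inl i))) x fun l => hM (some (.inl l)))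
    change TM2.stepAux (M (e none)) _ _ = _
    rw [hM none]
    simp [code, hp, cfg]
  | @ite_false p c d s t n hp _ ih =>
    intro L M e x hM
    refine ReachIn.trans (ReachIn.one ?_)
      (ih M (fun i => e (some (.inr i))) x fun l => hM (some (.inr l)))
    change TM2.stepAux (M (e none)) _ _ = _
    rw [hM none]
    simp [code, hp, cfg]
  | @loop_false p c s hp =>
    intro L M e x hM
    refine ReachIn.one ?_
    change TM2.stepAux (M (e none)) _ _ = _
    rw [hM none]
    simp [code, hp, cfg]
  | @loop_true p c s t u n k hp _ _ ih₁ ih₂ =>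
    intro L M e x hM
    refine ReachIn.trans (ReachIn.one ?_)
      ((ih₁ M (fun i => e (some i)) (e none) fun l => hM (some l)).trans (ih₂ M e x hM))
    change TM2.stepAux (M (e none)) _ _ = _
    rw [hM none]
    simp [code, hp, cfg]

/-- The final statement: move the answer to the output stack and halt. -/
def answer {L : Type} : TM2.Stmt Alph L Reg :=
  .pop (some .m) (fun _ o => (o, false))
    -- The register is reset because `haltList` prescribes the initial state.
    (.push none (fun r => decide (r.1 = some (Γ'.bit true))) (.load (fun _ => (none, false)) .halt))

/-- The stack machine of a program that leaves its answer on the main stack. -/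
noncomputable def machine (c : Cmd) : FinTM2 where
  K := Option Stk
  k₀ := some .m
  k₁ := none
  Γ := Alph
  Λ := Option (Lab c)
  main := some (entry c)
  ΛFin := Fintype.ofFinite _
  σ := Reg
  initialState := (none, false)
  Γk₀Fin := inferInstanceAs (Fintype Γ')
  m := fun l => match l with
    | none => answer
    | some l => code c some none l

/-- The extra step is `answer`. The stacks `a` and `b` have to end empty because `haltList` leaves
only the output. -/
theorem machine_outputs {c : Cmd} {w : List Γ'} {v : Bool} {r : Reg} {n k : ℕ} (hk : n + 1 ≤ k)
    (h : Run c ⟨(none, false), ⟨w, [], []⟩⟩ ⟨r, ⟨[Γ'.bit v], [], []⟩⟩ n) :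
    Nonempty (TM2OutputsInTime (machine c) w (some [v]) k) := by
  have key := (h.reachIn (machine c).m some none fun _ => rfl).trans (ReachIn.one rfl)
  refine ⟨⟨⟨n + 1, ?_⟩, hk⟩⟩
  have h₁ : initList (machine c) w = cfg (some (entry c)) ⟨(none, false), ⟨w, [], []⟩⟩ := by
    simp only [initList, cfg, machine]
    congr 1
    funext k'
    rcases k' with _ | (_ | _ | _) <;> rfl
  rw [h₁]
  refine Eq.trans key ?_
  change some _ = some _
  congr 1
  change TM2.stepAux answer _ _ = _
  simp only [answer, TM2.stepAux, haltList]
  congr 1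
  funext k'
  rcases k' with _ | (_ | _ | _)
  · cases v <;> rfl
  all_goals rfl

/-! ### Programs up to registers -/

/-- From any register, `c` takes the stacks from `s` to `t` in at most `n` steps. -/
def Does (c : Cmd) (n : ℕ) (s t : Mem) : Prop :=
  ∀ r, ∃ r' k, k ≤ n ∧ Run c ⟨r, s⟩ ⟨r', t⟩ k

theorem Does.mono {c : Cmd} {n n' : ℕ} {s t : Mem} (h : Does c n s t) (hn : n ≤ n') :
    Does c n' s t := fun r =>
  let ⟨r', k, hk, hr⟩ := h r
  ⟨r', k, hk.trans hn, hr⟩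

theorem Does.congr_right {c : Cmd} {n : ℕ} {s t t' : Mem} (h : Does c n s t) (ht : t = t') :
    Does c n s t' := ht ▸ h

theorem Does.congr_left {c : Cmd} {n : ℕ} {s s' t : Mem} (h : Does c n s t) (hs : s = s') :
    Does c n s' t := hs ▸ h

theorem Does.seq {c d : Cmd} {n n' : ℕ} {s t u : Mem} (h : Does c n s t) (h' : Does d n' t u) :
    Does (.seq c d) (n + n') s u := fun r =>
  let ⟨r', _, hk, hr⟩ := h r
  let ⟨r'', _, hk', hr'⟩ := h' r'
  ⟨r'', _, add_le_add hk hk', hr.seq hr'⟩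

def skip : Cmd := .op (.load id)

theorem does_skip (s : Mem) : Does skip 1 s s := fun r => ⟨r, 1, le_rfl, .op _ _⟩

def push (k : Stk) (x : Γ') : Cmd := .op (.push k fun _ => x)

theorem does_push (k : Stk) (x : Γ') (s : Mem) : Does (push k x) 1 s (s.set k (x :: s.get k)) :=
  fun r => ⟨r, 1, le_rfl, .op _ _⟩

def pop (k : Stk) : Cmd := .op (.pop k fun r _ => r)

theorem does_pop (k : Stk) (s : Mem) : Does (pop k) 1 s (s.set k (s.get k).tail) :=
  fun r => ⟨r, 1, le_rfl, .op _ _⟩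

def pushWord (k : Stk) : List Γ' → Cmd
  | [] => skip
  | x :: l => .seq (pushWord k l) (push k x)

theorem does_pushWord (l : List Γ') (M A B : List Γ') :
    Does (pushWord .m l) (l.length + 1) ⟨M, A, B⟩ ⟨l ++ M, A, B⟩ := by
  induction l with
  | nil => exact does_skip _
  | cons x l ih => exact (ih.seq (does_push .m x _)).mono (by simp)

/-- Move one symbol from `k` to `k'`. -/
def xfer (k k' : Stk) : Cmd :=
  .seq (.op (.pop k fun r o => (o, r.2))) (.op (.push k' fun r => r.1.getD .blank))

theorem does_xfer {k k' : Stk} {s : Mem} {x : Γ'} {l : List Γ'} (h : s.get k = x :: l) :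
    Does (xfer k k') 2 s ((s.set k l).set k' (x :: (s.set k l).get k')) := fun r => by
  refine ⟨(some x, r.2), 2, le_rfl, ?_⟩
  have := Run.seq (Run.op (.pop k fun r o => (o, r.2)) ⟨r, s⟩)
    (Run.op (.push k' fun r => r.1.getD .blank) _)
  simpa [xfer, Op.exec, h] using this

/-- Move one symbol from `k` to both `k'` and `k''`. -/
def xferTwo (k k' k'' : Stk) : Cmd :=
  .seq (xfer k k') (.op (.push k'' fun r => r.1.getD .blank))

theorem does_xferTwo {k k' k'' : Stk} {s t : Mem} {x : Γ'} {l : List Γ'} (h : s.get k = x :: l)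
    (ht : t = (s.set k l).set k' (x :: (s.set k l).get k')) :
    Does (xferTwo k k' k'') 3 s (t.set k'' (x :: t.get k'')) := fun r => by
  subst ht
  refine ⟨(some x, r.2), 3, le_rfl, ?_⟩
  have := (Run.seq (Run.op (.pop k fun r o => (o, r.2)) ⟨r, s⟩)
    (Run.op (.push k' fun r => r.1.getD .blank) _)).seq
      (Run.op (.push k'' fun r => r.1.getD .blank) _)
  simpa [xfer, xferTwo, Op.exec, h] using this

def look (k : Stk) : Cmd := .op (.peek k fun _ o => (o, false))

/-- Branch on the topmost symbol of `k`. -/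
def ifTop (k : Stk) (p : Option Γ' → Bool) (c d : Cmd) : Cmd :=
  .seq (look k) (.ite (fun r => p r.1) c d)

theorem Does.ifTop_true {k : Stk} {p : Option Γ' → Bool} {c d : Cmd} {n : ℕ} {s t : Mem}
    (hp : p (s.get k).head? = true) (h : Does c n s t) : Does (ifTop k p c d) (n + 2) s t :=
  fun r => by
  obtain ⟨r', i, hi, hr⟩ := h ((s.get k).head?, false)
  exact ⟨r', _, by omega, (Run.op _ ⟨r, s⟩).seq (.ite_true (by exact hp) hr)⟩

theorem Does.ifTop_false {k : Stk} {p : Option Γ' → Bool} {c d : Cmd} {n : ℕ} {s t : Mem}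
    (hp : p (s.get k).head? = false) (h : Does d n s t) : Does (ifTop k p c d) (n + 2) s t :=
  fun r => by
  obtain ⟨r', i, hi, hr⟩ := h ((s.get k).head?, false)
  exact ⟨r', _, by omega, (Run.op _ ⟨r, s⟩).seq (.ite_false (by exact hp) hr)⟩

/-- Repeat while the topmost symbol of `k` satisfies `p`. -/
def whileTop (k : Stk) (p : Option Γ' → Bool) (c : Cmd) : Cmd :=
  .seq (look k) (.loop (fun r => p r.1) (.seq c (look k)))

theorem does_whileTop_stop {k : Stk} {p : Option Γ' → Bool} {c : Cmd} {s : Mem}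
    (hp : p (s.get k).head? = false) : Does (whileTop k p c) 2 s s :=
  fun r => ⟨_, _, le_rfl, (Run.op _ ⟨r, s⟩).seq (.loop_false (by exact hp))⟩

theorem Does.whileTop {k : Stk} {p : Option Γ' → Bool} {c : Cmd} {n n' : ℕ} {s t u : Mem}
    (hp : p (s.get k).head? = true) (h : Does c n s t) (h' : Does (whileTop k p c) n' t u) :
    Does (whileTop k p c) (n + n' + 2) s u := fun r => by
  obtain ⟨r₁, i, hi, h₁⟩ := h ((s.get k).head?, false)
  obtain ⟨r₂, j, hj, h₂⟩ := h' r₁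
  -- The `look` that opens the second run becomes the `look` that closes the loop body.
  cases h₂ with
  | seq ha hb =>
    cases ha
    exact ⟨r₂, _, by omega, (Run.op _ ⟨r, s⟩).seq
      (.loop_true (by exact hp) (h₁.seq (Run.op _ _)) hb)⟩

/-- Move the symbols above the first blank from `k` to `k'` and delete that blank. -/
def shift (k k' : Stk) : Cmd :=
  .seq (whileTop k (· ≠ some .blank) (xfer k k')) (pop k)

@[simp] theorem Mem.get_set (s : Mem) (k : Stk) (l : List Γ') : (s.set k l).get k = l := by
  cases k <;> rfl

@[simp] theorem Mem.set_set (s : Mem) (k : Stk) (l l' : List Γ') :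
    (s.set k l).set k l' = s.set k l' := by
  cases k <;> rfl

theorem Mem.get_set_ne (s : Mem) {k k' : Stk} (h : k ≠ k') (l : List Γ') :
    (s.set k l).get k' = s.get k' := by
  cases k <;> cases k' <;> first | rfl | exact absurd rfl h

theorem Mem.set_comm (s : Mem) {k k' : Stk} (h : k ≠ k') (l l' : List Γ') :
    (s.set k l).set k' l' = (s.set k' l').set k l := by
  cases k <;> cases k' <;> first | rfl | exact absurd rfl h

theorem does_shift {k k' : Stk} (hk : k ≠ k') {w R : List Γ'} (hw : Γ'.blank ∉ w) {s : Mem}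
    (h : s.get k = w ++ .blank :: R) :
    Does (shift k k') (4 * w.length + 3) s ((s.set k R).set k' (w.reverse ++ s.get k')) := by
  have loop : ∀ (w : List Γ') (s : Mem), Γ'.blank ∉ w → s.get k = w ++ .blank :: R →
      Does (whileTop k (· ≠ some .blank) (xfer k k')) (4 * w.length + 2) s
        ((s.set k (.blank :: R)).set k' (w.reverse ++ s.get k')) := by
    intro w
    induction w with
    | nil =>
      intro s _ h
      have : (s.set k (.blank :: R)).set k' ([] ++ s.get k') = s := by
        rw [List.nil_append] at h ⊢
        rw [← h]
        cases k <;> cases k' <;> rfl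
      rw [List.reverse_nil, this]
      exact does_whileTop_stop (by simp [h])
    | cons x w ih =>
      intro s hw h
      simp only [List.mem_cons, not_or] at hw
      have h₁ := does_xfer (k' := k') (l := w ++ .blank :: R) h
      have h₂ := ih ((s.set k (w ++ .blank :: R)).set k' (x :: (s.set k (w ++ .blank :: R)).get k'))
        hw.2 (by rw [Mem.get_set_ne _ hk.symm, Mem.get_set])
      have := h₁.whileTop (p := (· ≠ some .blank)) (k := k) (by simp [h, Ne.symm hw.1]) h₂
      refine (this.mono (by simp; omega)).congr_right ?_
      rw [Mem.set_comm _ hk, Mem.set_set, Mem.set_comm _ hk.symm, Mem.set_set, Mem.get_set,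
        Mem.get_set_ne _ hk, Mem.set_comm _ hk]
      simp [Mem.set_comm _ hk]
  refine ((loop w s hw h).seq (does_pop k _)).congr_right ?_
  rw [Mem.get_set_ne _ hk.symm, Mem.get_set, Mem.set_comm _ hk.symm, Mem.set_set]
  rfl

/-! ### Types of stack items -/

/-- A type whose elements are written on a stack by a self-delimiting code `enc`, with a program
`mv` that moves an item from the main stack to the stack `a` in linear time. -/
class Item (α : Type) where
  enc : α → List Γ'
  mv : Cmd
  cost : ℕ
  selfDelim : SelfDelim enc
  noKet : NoKet enc
  noBlank : ∀ x, Γ'.blank ∉ enc x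
  does_mv : ∀ x M A B,
    Does mv (cost * (enc x).length) ⟨enc x ++ M, A, B⟩ ⟨M, (enc x).reverse ++ A, B⟩

open Item

/-- The length of the code of an item. -/
def size {α : Type} [Item α] (x : α) : ℕ := (enc x).length

theorem size_pos {α : Type} [Item α] (x : α) : 0 < size x := by
  obtain ⟨c, l, h, -⟩ := noKet x
  simp [size, h]

theorem enc_injective {α : Type} [Item α] : Function.Injective (enc : α → List Γ') :=
  fun x y h => (selfDelim x y [] [] (by simpa using h)).1

/-- Types embedded into a type of items. -/
@[reducible] def Item.ofInjective {α β : Type} [Item β] (f : α → β) (hf : Function.Injective f) :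
    Item α where
  enc x := enc (f x)
  mv := mv β
  cost := cost β
  selfDelim _ _ s t h := (selfDelim _ _ s t h).imp (fun h => hf h) id
  noKet x := noKet (f x)
  noBlank x := noBlank (f x)
  does_mv x := does_mv (f x)

instance : Item Bool where
  enc b := [Γ'.bit b]
  mv := xfer .m .a
  cost := 2
  selfDelim a b s t h := by simpa using h
  noKet b := ⟨_, _, rfl, by simp⟩
  noBlank b := by simp
  does_mv b M A B := does_xfer (s := ⟨Γ'.bit b :: M, A, B⟩) rfl

instance : Item ℕ where
  enc := encNat
  mv := .seq (whileTop .m (· ≠ some .comma) (xfer .m .a)) (xfer .m .a)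
  cost := 4
  selfDelim := selfDelim_encNat
  noKet := noKet_encNat
  noBlank n := by simp [encNat]
  does_mv n M A B := by
    have loop : ∀ (l : List Bool) (A : List Γ'),
        Does (whileTop .m (· ≠ some .comma) (xfer .m .a)) (4 * l.length + 2)
          ⟨l.map Γ'.bit ++ .comma :: M, A, B⟩ ⟨.comma :: M, (l.map Γ'.bit).reverse ++ A, B⟩ := by
      intro l
      induction l with
      | nil => exact fun A => does_whileTop_stop rfl
      | cons x l ih =>
        intro A
        have h₁ := does_xfer (k := .m) (k' := .a) (s := ⟨(x :: l).map Γ'.bit ++ .comma :: M, A, B⟩)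
          rfl
        refine ((h₁.whileTop (by simp [Mem.get]) (ih _)).mono (by simp; omega)).congr_right ?_
        simp [Mem.set, Mem.get]
    have := (loop (Computability.encodeNat n) A).seq (does_xfer (k := .m) (k' := .a) rfl)
    refine ((this.mono (n' := 4 * (encNat n).length) (by simp [encNat]; omega)).congr_right
      (t' := ⟨M, (encNat n).reverse ++ A, B⟩) ?_).congr_left ?_
    · simp [Mem.set, Mem.get, encNat]
    · simp [encNat]

instance {α β : Type} [Item α] [Item β] : Item (α × β) where
  enc x := enc x.1 ++ enc x.2
  mv := .seq (mv α) (mv β)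
  cost := cost α + cost β
  selfDelim := by
    rintro ⟨a, b⟩ ⟨a', b'⟩ s t h
    simp only [List.append_assoc] at h
    obtain ⟨h₁, h⟩ := selfDelim _ _ _ _ h
    obtain ⟨h₂, h⟩ := selfDelim _ _ _ _ h
    exact ⟨Prod.ext h₁ h₂, h⟩
  noKet x := by
    obtain ⟨c, l, h, hc⟩ := noKet x.1
    exact ⟨c, l ++ enc x.2, by simp [h], hc⟩
  noBlank x := by simp [noBlank]
  does_mv x M A B := by
    have := (does_mv x.1 (enc x.2 ++ M) A B).seq (does_mv x.2 M _ B)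
    rw [List.append_assoc, List.reverse_append, List.append_assoc]
    refine this.mono ?_
    simp only [List.length_append]
    nlinarith

/-- The codes of the members of a list, followed by the closing bracket. -/
def encTail {α : Type} [Item α] (l : List α) : List Γ' := l.flatMap enc ++ [Γ'.ket]

@[simp] theorem encTail_nil {α : Type} [Item α] : encTail ([] : List α) = [Γ'.ket] := rfl

@[simp] theorem encTail_cons {α : Type} [Item α] (x : α) (l : List α) :
    encTail (x :: l) = enc x ++ encTail l := by simp [encTail]

theorem head?_enc_append_ne {α : Type} [Item α] (x : α) (M : List Γ') :
    decide ((enc x ++ M).head? ≠ some Γ'.ket) = true := by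
  obtain ⟨c, l, h, hc⟩ := noKet x
  simpa [h] using hc

instance {α : Type} [Item α] : Item (List α) where
  enc := encList enc
  mv := .seq (xfer .m .a) (.seq (whileTop .m (· ≠ some .ket) (mv α)) (xfer .m .a))
  cost := cost α + 4
  selfDelim := selfDelim_encList selfDelim noKet
  noKet := noKet_encList enc
  noBlank l := by simp [encList, noBlank]
  does_mv l M A B := by
    have h₁ := does_xfer (k := .m) (k' := .a) (s := ⟨encList enc l ++ M, A, B⟩)
      (x := .bra) (l := encTail l ++ M) rfl
    have h₂ : Does (whileTop .m (· ≠ some .ket) (mv α)) ((cost α + 2) * (encTail l).length)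
        ⟨encTail l ++ M, .bra :: A, B⟩ ⟨.ket :: M, (l.flatMap enc).reverse ++ .bra :: A, B⟩ := by
      have : ∀ (l : List α) (A : List Γ'),
          Does (whileTop .m (· ≠ some .ket) (mv α)) ((cost α + 2) * (encTail l).length)
            ⟨encTail l ++ M, A, B⟩ ⟨.ket :: M, (l.flatMap enc).reverse ++ A, B⟩ := by
        intro l
        induction l with
        | nil => exact fun A => (does_whileTop_stop rfl).mono (by simp)
        | cons x l ih =>
          intro A
          rw [encTail_cons, List.append_assoc, List.flatMap_cons, List.reverse_append,
            List.append_assoc]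
          refine ((does_mv x (encTail l ++ M) A B).whileTop ?_ (ih _)).mono ?_
          · exact head?_enc_append_ne x (encTail l ++ M)
          · have := size_pos x
            simp only [List.length_append, size] at *
            nlinarith
      -- The loop was proved for every content of `a`, since that stack grows from one round to the
      -- next.
      exact this l _
    have h₃ := does_xfer (k := .m) (k' := .a)
      (s := ⟨.ket :: M, (l.flatMap enc).reverse ++ .bra :: A, B⟩) rfl
    refine ((h₁.seq (h₂.seq h₃)).mono ?_).congr_right ?_
    · simp only [encTail, encList, List.length_append, List.length_cons, List.length_nil]
      nlinarith
    · simp [Mem.set, Mem.get, encList]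

/-! ### Functions on items computed in polynomial time -/

/-- Some program replaces the item `x` on top of the main stack by `f x`, whatever lies below, in
time polynomial in the size of `x`. -/
def Poly {α β : Type} [Item α] [Item β] (f : α → β) : Prop :=
  ∃ (c : Cmd) (P : Polynomial ℕ), ∀ x, size (f x) ≤ P.eval (size x) ∧
    ∀ M A B, Does c (P.eval (size x)) ⟨enc x ++ M, A, B⟩ ⟨enc (f x) ++ M, A, B⟩

theorem eval_le_eval (P : Polynomial ℕ) {n k : ℕ} (h : n ≤ k) : P.eval n ≤ P.eval k := by
  simp only [Polynomial.eval_eq_sum]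
  exact Finset.sum_le_sum fun i _ => Nat.mul_le_mul_left _ (Nat.pow_le_pow_left h i)

section

variable {α β γ δ : Type} [Item α] [Item β] [Item γ] [Item δ]

theorem Poly.of_eq {f g : α → β} (hf : Poly f) (h : ∀ x, f x = g x) : Poly g :=
  (funext h : f = g) ▸ hf

theorem does_pop_m (x : Γ') (M A B : List Γ') : Does (pop .m) 1 ⟨x :: M, A, B⟩ ⟨M, A, B⟩ :=
  does_pop .m _

/-- A function that does not change the code. -/
theorem Poly.of_enc_eq {f : α → β} (h : ∀ x, enc (f x) = enc x) : Poly f := by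
  refine ⟨skip, .X + 1, fun x => ⟨by simp [size, h], fun M A B => ?_⟩⟩
  rw [h]
  exact (does_skip _).mono (by simp)

theorem Poly.id : Poly (fun x : α => x) := .of_enc_eq fun _ => rfl

/-- The output size bound contained in `Poly` is what bounds the time of the second program. -/
theorem Poly.comp {g : β → γ} {f : α → β} (hg : Poly g) (hf : Poly f) :
    Poly (fun x => g (f x)) := by
  obtain ⟨c, P, hc⟩ := hf
  obtain ⟨d, Q, hd⟩ := hg
  refine ⟨.seq c d, P + Q.comp P, fun x => ?_⟩
  have hm := eval_le_eval Q (hc x).1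
  simp only [Polynomial.eval_add, Polynomial.eval_comp]
  exact ⟨((hd (f x)).1.trans hm).trans (Nat.le_add_left _ _), fun M A B =>
    (((hc x).2 M A B).seq ((hd (f x)).2 M A B)).mono (Nat.add_le_add_left hm _)⟩

theorem size_prod (x : α × β) : size x = size x.1 + size x.2 := List.length_append

/-- Move the top item to the stack `a`, above a blank. -/
def stash (α : Type) [Item α] : Cmd := .seq (push .a .blank) (mv α)

theorem does_stash (x : α) (M A B : List Γ') :
    Does (stash α) (cost α * size x + 1) ⟨enc x ++ M, A, B⟩
      ⟨M, (enc x).reverse ++ .blank :: A, B⟩ :=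
  ((does_push .a .blank _).seq (does_mv x M (.blank :: A) B)).mono (by simp only [size]; omega)

/-- Move the topmost stashed item back. -/
def unstash : Cmd := shift .a .m

theorem does_unstash (x : α) (M A B : List Γ') :
    Does unstash (4 * size x + 3) ⟨M, (enc x).reverse ++ .blank :: A, B⟩ ⟨enc x ++ M, A, B⟩ := by
  have := does_shift (k := .a) (k' := .m) (w := (enc x).reverse) (R := A) (by simp)
    (by simpa using noBlank x) (s := ⟨M, (enc x).reverse ++ .blank :: A, B⟩) rfl
  simpa [unstash, Mem.set, Mem.get, size] using this

/-- Run `c` below the top item. -/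
def dip (α : Type) [Item α] (c : Cmd) : Cmd := .seq (stash α) (.seq c unstash)

theorem Does.dip {c : Cmd} {n : ℕ} {M M' B : List Γ'} (x : α) (A : List Γ')
    (h : ∀ A, Does c n ⟨M, A, B⟩ ⟨M', A, B⟩) :
    Does (dip α c) (n + (cost α + 4) * size x + 4) ⟨enc x ++ M, A, B⟩ ⟨enc x ++ M', A, B⟩ :=
  ((does_stash x M A B).seq ((h _).seq (does_unstash x M' A B))).mono (by
    rw [add_mul]; omega)

/-- Delete the symbols of `k` above the first blank, and that blank. -/
def wipe (k : Stk) : Cmd := .seq (whileTop k (· ≠ some .blank) (pop k)) (pop k)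

theorem does_wipe {k : Stk} {w R : List Γ'} (hw : Γ'.blank ∉ w) {s : Mem}
    (h : s.get k = w ++ .blank :: R) : Does (wipe k) (3 * w.length + 3) s (s.set k R) := by
  have loop : ∀ (w : List Γ') (s : Mem), Γ'.blank ∉ w → s.get k = w ++ .blank :: R →
      Does (whileTop k (· ≠ some .blank) (pop k)) (3 * w.length + 2) s
        (s.set k (.blank :: R)) := by
    intro w
    induction w with
    | nil =>
      intro s _ h
      have : s.set k (.blank :: R) = s := by
        rw [List.nil_append] at h
        rw [← h]
        cases k <;> rfl
      rw [this]
      exact does_whileTop_stop (by simp [h])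
    | cons x w ih =>
      intro s hw h
      simp only [List.mem_cons, not_or] at hw
      have h₁ := does_pop k s
      rw [h, List.cons_append, List.tail_cons] at h₁
      have h₂ := ih (s.set k (w ++ .blank :: R)) hw.2 (by simp)
      refine ((h₁.whileTop (by simp [h, Ne.symm hw.1]) h₂).mono (by simp; omega)).congr_right ?_
      simp
  refine ((loop w s hw h).seq (does_pop k _)).congr_right ?_
  simp

/-- Delete the top item. -/
def drop (α : Type) [Item α] : Cmd := .seq (stash α) (wipe .a)

theorem does_drop (x : α) (M A B : List Γ') :
    Does (drop α) ((cost α + 3) * size x + 4) ⟨enc x ++ M, A, B⟩ ⟨M, A, B⟩ := by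
  have := does_wipe (k := .a) (w := (enc x).reverse) (R := A)
    (by simpa using noBlank x) (s := ⟨M, (enc x).reverse ++ .blank :: A, B⟩) rfl
  refine ((does_stash x M A B).seq this).mono ?_
  simp only [size, List.length_reverse, add_mul]
  omega

/-- Copy the top item. -/
def copy (α : Type) [Item α] : Cmd :=
  .seq (stash α) (.seq (push .b .blank) (.seq (whileTop .a (· ≠ some .blank) (xferTwo .a .m .b))
    (.seq (shift .b .a) unstash)))

theorem does_copy (x : α) (M A B : List Γ') :
    Does (copy α) ((cost α + 13) * size x + 12) ⟨enc x ++ M, A, B⟩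
      ⟨enc x ++ (enc x ++ M), A, B⟩ := by
  have loop : ∀ (w M B : List Γ'), Γ'.blank ∉ w →
      Does (whileTop .a (· ≠ some .blank) (xferTwo .a .m .b)) (5 * w.length + 2)
        ⟨M, w ++ .blank :: A, B⟩ ⟨w.reverse ++ M, .blank :: A, w.reverse ++ B⟩ := by
    intro w
    induction w with
    | nil => exact fun M B _ => does_whileTop_stop rfl
    | cons x w ih =>
      intro M B hw
      simp only [List.mem_cons, not_or] at hw
      have h₁ := does_xferTwo (k := .a) (k' := .m) (k'' := .b)
        (s := ⟨M, x :: w ++ .blank :: A, B⟩) rfl rfl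
      refine ((h₁.whileTop (by simp [Mem.get, Ne.symm hw.1]) (ih (x :: M) (x :: B) hw.2)).mono
        (by simp; omega)).congr_right ?_
      simp
  have hx := noBlank x
  have h₁ := does_stash x M A B
  have h₂ := does_push .b .blank ⟨M, (enc x).reverse ++ .blank :: A, B⟩
  have h₃ := loop (enc x).reverse M (.blank :: B) (by simpa using hx)
  rw [List.reverse_reverse] at h₃
  have h₄ := does_shift (k := .b) (k' := .a) (by simp) hx
    (s := ⟨enc x ++ M, .blank :: A, enc x ++ .blank :: B⟩) rfl
  have h₅ := does_unstash x (enc x ++ M) A B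
  refine (h₁.seq (h₂.seq (h₃.seq (h₄.seq h₅)))).mono ?_
  simp only [size, List.length_reverse, add_mul]
  omega

/-- The code of a pair is a concatenation, so the second component counts as part of what lies below
the top item. -/
theorem Poly.first {f : α → β} (hf : Poly f) : Poly (fun x : α × γ => (f x.1, x.2)) := by
  obtain ⟨c, P, hc⟩ := hf
  refine ⟨c, P + .X, fun x => ?_⟩
  have hm := eval_le_eval P (show size x.1 ≤ size x by rw [size_prod]; omega)
  have hx := (hc x.1).1
  simp only [Polynomial.eval_add, Polynomial.eval_X]
  refine ⟨?_, fun M A B => ?_⟩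
  · rw [size_prod (_, _)]
    have := size_prod x
    dsimp only
    omega
  · have := (hc x.1).2 (enc x.2 ++ M) A B
    simp only [← List.append_assoc] at this
    exact this.mono (by omega)

theorem Poly.second {f : α → β} (hf : Poly f) : Poly (fun x : γ × α => (x.1, f x.2)) := by
  obtain ⟨c, P, hc⟩ := hf
  refine ⟨dip γ c, P + Polynomial.C (cost γ + 4) * .X + 4, fun x => ?_⟩
  have hm := eval_le_eval P (show size x.2 ≤ size x by rw [size_prod]; omega)
  have hx := (hc x.2).1
  have hX : size x.1 ≤ size x := by rw [size_prod]; omega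
  simp only [Polynomial.eval_add, Polynomial.eval_mul, Polynomial.eval_C, Polynomial.eval_X,
    Polynomial.eval_ofNat]
  refine ⟨?_, fun M A B => ?_⟩
  · rw [size_prod (_, _)]
    simp only [add_mul]
    omega
  · have := Does.dip x.1 A fun A => (hc x.2).2 M A B
    simp only [← List.append_assoc] at this
    refine this.mono ?_
    have := Nat.mul_le_mul_left (cost γ + 4) hX
    omega

theorem Poly.fst : Poly (fun x : α × β => x.1) := by
  refine ⟨dip α (drop β), Polynomial.C (cost α + cost β + 7) * .X + 8, fun x => ?_⟩
  simp only [Polynomial.eval_add, Polynomial.eval_mul, Polynomial.eval_C, Polynomial.eval_X,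
    Polynomial.eval_ofNat, size_prod x]
  refine ⟨by nlinarith, fun M A B => ?_⟩
  have := Does.dip x.1 A fun A => does_drop x.2 M A B
  simp only [← List.append_assoc] at this
  exact this.mono (by nlinarith)

theorem Poly.snd : Poly (fun x : α × β => x.2) := by
  refine ⟨drop α, Polynomial.C (cost α + 3) * .X + 4, fun x => ?_⟩
  simp only [Polynomial.eval_add, Polynomial.eval_mul, Polynomial.eval_C, Polynomial.eval_X,
    Polynomial.eval_ofNat, size_prod x]
  refine ⟨by nlinarith, fun M A B => ?_⟩
  have := does_drop x.1 (enc x.2 ++ M) A B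
  simp only [← List.append_assoc] at this
  exact this.mono (by nlinarith)

theorem Poly.diag : Poly (fun x : α => (x, x)) := by
  refine ⟨copy α, Polynomial.C (cost α + 13) * .X + 12, fun x => ?_⟩
  simp only [Polynomial.eval_add, Polynomial.eval_mul, Polynomial.eval_C, Polynomial.eval_X,
    Polynomial.eval_ofNat, size_prod (x, x)]
  refine ⟨by nlinarith, fun M A B => ?_⟩
  have := does_copy x M A B
  simp only [← List.append_assoc] at this
  exact this

theorem Poly.pair {f : α → β} {g : α → γ} (hf : Poly f) (hg : Poly g) :
    Poly (fun x => (f x, g x)) :=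
  (Poly.second hg).comp ((Poly.first hf).comp Poly.diag)

theorem Poly.const (y : β) : Poly (fun _ : α => y) := by
  refine ⟨.seq (drop α) (pushWord .m (enc y)),
    Polynomial.C (cost α + 3) * .X + 4 + Polynomial.C (size y + 1), fun x => ?_⟩
  simp only [Polynomial.eval_add, Polynomial.eval_mul, Polynomial.eval_C, Polynomial.eval_X,
    Polynomial.eval_ofNat]
  exact ⟨by omega, fun M A B => (does_drop x M A B).seq (does_pushWord (enc y) M A B)⟩

/-- The test is run on a copy of the input; its one-symbol result is inspected and popped before a
branch works on the original. -/
theorem Poly.ite {p : α → Bool} {f g : α → β} (hp : Poly p) (hf : Poly f) (hg : Poly g) :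
    Poly (fun x => if p x then f x else g x) := by
  obtain ⟨c, P, hc⟩ := (Poly.first (γ := α) hp).comp Poly.diag
  obtain ⟨d, Q, hd⟩ := hf
  obtain ⟨e, R, he⟩ := hg
  refine ⟨.seq c (ifTop .m (· = some (.bit true)) (.seq (pop .m) d) (.seq (pop .m) e)),
    P + Q + R + 3, fun x => ?_⟩
  simp only [Polynomial.eval_add, Polynomial.eval_ofNat]
  have hcx := (hc x).2
  cases hpx : p x with
  | true =>
    refine ⟨(hd x).1.trans (by omega), fun M A B => ?_⟩
    have h := hcx M A B
    have h' := (does_pop_m (.bit true) _ A B).seq ((hd x).2 M A B)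
    have h'' := h'.ifTop_true (k := .m) (p := (· = some (.bit true))) (d := .seq (pop .m) e) rfl
    refine (h.seq (h''.congr_left ?_)).mono (by omega)
    simp [enc, hpx]
  | false =>
    refine ⟨(he x).1.trans (by omega), fun M A B => ?_⟩
    have h := hcx M A B
    have h' := (does_pop_m (.bit false) _ A B).seq ((he x).2 M A B)
    have h'' := h'.ifTop_false (k := .m) (p := (· = some (.bit true))) (c := .seq (pop .m) d) rfl
    refine (h.seq (h''.congr_left ?_)).mono (by omega)
    simp [enc, hpx]

end

/-! ### Equality of items -/

/-- Put `false` on the stack `a` in place of the topmost symbol. -/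
def refute : Cmd := .seq (pop .a) (push .a (.bit false))

theorem does_refute (x : Γ') (M A B : List Γ') :
    Does refute 2 ⟨M, x :: A, B⟩ ⟨M, .bit false :: A, B⟩ :=
  (does_pop .a _).seq (does_push .a _ _)

/-- Compare the topmost symbols of `m` and `b`. -/
def cmp : Cmd :=
  .seq (.op (.pop .m fun _ o => (o, false))) (.seq (.op (.peek .b fun r o => (r.1, r.1 = o)))
    (.ite (fun r => r.2) (pop .b) refute))

theorem does_cmp_eq (x : Γ') (M A B : List Γ') :
    Does cmp 4 ⟨x :: M, A, x :: B⟩ ⟨M, A, B⟩ := fun r =>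
  ⟨_, _, le_rfl, (Run.op _ ⟨r, _⟩).seq ((Run.op _ _).seq
    (.ite_true (by simp [Op.exec, Mem.get, Mem.set]) (Run.op _ _)))⟩

theorem does_cmp_ne {x : Γ'} {M A B : List Γ'} (v : Γ') (h : some x ≠ B.head?) :
    Does cmp 5 ⟨x :: M, v :: A, B⟩ ⟨M, .bit false :: A, B⟩ := fun r => by
  obtain ⟨r', k, hk, hr⟩ := does_refute v M A B (some x, false)
  refine ⟨r', _, ?_, (Run.op _ ⟨r, _⟩).seq ((Run.op _ _).seq
    (.ite_false (decide_eq_false h)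
      (t := ⟨r', ⟨M, .bit false :: A, B⟩⟩) (n := k) ?_))⟩
  · omega
  · simpa [Op.exec, Mem.get, Mem.set, h] using hr

/-- The flag on `a` stays true as long as no mismatch has occurred. A mismatch removes nothing from
`b`, so the blank there is never consumed. The words are equal exactly if the flag survives and
nothing is left of the word on `b`. -/
theorem does_cmp_loop (M A B : List Γ') : ∀ (u w : List Γ') (v : Bool),
    Γ'.blank ∉ u → Γ'.blank ∉ w → ∃ (w' : List Γ') (v' : Bool), Γ'.blank ∉ w' ∧
      w'.length ≤ w.length ∧ ((v' = true ∧ w' = []) ↔ (v = true ∧ u = w)) ∧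
      Does (whileTop .m (· ≠ some .blank) cmp) (7 * u.length + 2)
        ⟨u ++ .blank :: M, .bit v :: A, w ++ .blank :: B⟩
        ⟨.blank :: M, .bit v' :: A, w' ++ .blank :: B⟩ := by
  intro u
  induction u with
  | nil =>
    intro w v _ hw
    exact ⟨w, v, hw, le_rfl, by simp [eq_comm], does_whileTop_stop rfl⟩
  | cons x u ih =>
    intro w v hu hw
    simp only [List.mem_cons, not_or] at hu
    have ht : (fun o : Option Γ' => decide (o ≠ some .blank)) (Mem.get
        ⟨x :: u ++ .blank :: M, .bit v :: A, w ++ .blank :: B⟩ .m).head? = true := by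
      simp [Mem.get, Ne.symm hu.1]
    by_cases hx : some x = (w ++ .blank :: B).head?
    · cases w with
      | nil => exact absurd (by simpa using hx) (Ne.symm hu.1)
      | cons y w =>
        obtain rfl : x = y := by simpa using hx
        obtain ⟨w', v', h₁, h₂, h₃, h₄⟩ := ih w v hu.2 fun h => hw (List.mem_cons_of_mem _ h)
        refine ⟨w', v', h₁, h₂.trans (by simp), by simpa using h₃, ?_⟩
        exact ((does_cmp_eq x _ _ _).whileTop ht h₄).mono (by simp; omega)
    · obtain ⟨w', v', h₁, h₂, h₃, h₄⟩ := ih w false hu.2 hw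
      refine ⟨w', v', h₁, h₂, h₃.trans ?_, ?_⟩
      · have : x :: u ≠ w := by rintro rfl; simp at hx
        simp [this]
      · exact ((does_cmp_ne _ hx).whileTop ht h₄).mono (by simp; omega)

/-- Compare the two topmost items, whose codes lie above a blank on `m` and on `b`. -/
def cmpWords : Cmd :=
  .seq (push .a (.bit true)) (.seq (whileTop .m (· ≠ some .blank) cmp)
    (.seq (ifTop .b (· ≠ some .blank) refute skip) (.seq (wipe .b) (.seq (pop .m) (xfer .a .m)))))

theorem does_cmpWords {u w : List Γ'} (M A B : List Γ') (hu : Γ'.blank ∉ u) (hw : Γ'.blank ∉ w) :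
    Does cmpWords (7 * u.length + 3 * w.length + 13) ⟨u ++ .blank :: M, A, w ++ .blank :: B⟩
      ⟨.bit (decide (u = w)) :: M, A, B⟩ := by
  obtain ⟨w', v', h₁, h₂, h₃, h₄⟩ := does_cmp_loop M A B u w true hu hw
  have h₅ := does_push .a (.bit true) ⟨u ++ .blank :: M, A, w ++ .blank :: B⟩
  have h₆ : Does (ifTop .b (· ≠ some .blank) refute skip) 4
      ⟨.blank :: M, .bit v' :: A, w' ++ .blank :: B⟩
      ⟨.blank :: M, .bit (decide (u = w)) :: A, w' ++ .blank :: B⟩ := by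
    rw [eq_self, true_and] at h₃
    cases w' with
    | nil =>
      have : decide (u = w) = v' := by
        cases v' <;> simp_all
      rw [this]
      exact ((does_skip _).ifTop_false (by simp [Mem.get])).mono (by simp)
    | cons y w' =>
      have : decide (u = w) = false := by simpa using h₃
      rw [this]
      simp only [List.mem_cons, not_or] at h₁
      exact (does_refute _ _ _ _).ifTop_true (by simp [Mem.get, Ne.symm h₁.1])
  have h₇ := does_wipe (k := .b) h₁
    (s := ⟨.blank :: M, .bit (decide (u = w)) :: A, w' ++ .blank :: B⟩) rfl
  have h₈ := does_pop_m .blank M (.bit (decide (u = w)) :: A) B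
  have h₉ := does_xfer (k := .a) (k' := .m) (s := ⟨M, .bit (decide (u = w)) :: A, B⟩) rfl
  exact (h₅.seq (h₄.seq (h₆.seq (h₇.seq (h₈.seq h₉))))).mono (by omega)

section

variable {α β γ : Type} [Item α] [Item β] [Item γ]

/-- Codes are injective, so it is enough to compare them symbol by symbol, one on `m` and the other
on `b`. -/
theorem Poly.eq [DecidableEq α] : Poly (fun x : α × α => decide (x.1 = x.2)) := by
  refine ⟨.seq (stash α) (.seq (stash α) (.seq (push .b .blank) (.seq (shift .a .b)
    (.seq (push .m .blank) (.seq (shift .a .m) cmpWords))))),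
    Polynomial.C (cost α + 20) * .X + 30, fun x => ?_⟩
  simp only [Polynomial.eval_add, Polynomial.eval_mul, Polynomial.eval_C, Polynomial.eval_X,
    Polynomial.eval_ofNat]
  refine ⟨by simp only [size, enc, List.length_singleton]; omega, fun M A B => ?_⟩
  have hx := noBlank x.1
  have hy := noBlank x.2
  have h₁ := does_stash x.1 (enc x.2 ++ M) A B
  have h₂ := does_stash x.2 M ((enc x.1).reverse ++ .blank :: A) B
  have h₃ := does_push .b .blank
    ⟨M, (enc x.2).reverse ++ .blank :: ((enc x.1).reverse ++ .blank :: A), B⟩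
  have h₄ := does_shift (k := .a) (k' := .b) (by simp) (by simpa using hy)
    (s := ⟨M, (enc x.2).reverse ++ .blank :: ((enc x.1).reverse ++ .blank :: A), .blank :: B⟩) rfl
  have h₅ := does_push .m .blank ⟨M, (enc x.1).reverse ++ .blank :: A, enc x.2 ++ .blank :: B⟩
  have h₆ := does_shift (k := .a) (k' := .m) (by simp) (by simpa using hx)
    (s := ⟨.blank :: M, (enc x.1).reverse ++ .blank :: A, enc x.2 ++ .blank :: B⟩) rfl
  have h₇ := does_cmpWords M A B hx hy
  simp only [List.reverse_reverse, Mem.set, Mem.get] at h₄ h₆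
  have := (h₁.seq (h₂.seq (h₃.seq (h₄.seq (h₅.seq (h₆.seq h₇))))))
  simp only [enc_injective.eq_iff, ← List.append_assoc] at this
  refine this.mono ?_
  rw [size_prod]
  simp only [size, List.length_reverse]
  nlinarith

/-! ### Lists -/

theorem size_list (l : List α) : size l = 1 + (encTail l).length := by
  change (encList enc l).length = _
  simp [encList, encTail, add_comm]

theorem size_nil : size ([] : List α) = 2 := rfl

theorem size_cons (x : α) (l : List α) : size (x :: l) = size x + size l := by
  rw [size_list, size_list, encTail_cons, List.length_append, size]; omega

theorem size_append (l l' : List α) : size (l ++ l') + 2 = size l + size l' := by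
  induction l with
  | nil => simp [size_nil]; omega
  | cons x l ih => simp only [List.cons_append, size_cons]; omega

theorem enc_list (l : List α) : enc l = .bra :: encTail l := rfl

/-- Only the opening bracket of the list has to move: from below the code of the new head to above
it. -/
theorem Poly.cons : Poly (fun x : α × List α => x.1 :: x.2) := by
  refine ⟨.seq (dip α (pop .m)) (push .m .bra), Polynomial.C (cost α + 5) * .X + 10, fun x => ?_⟩
  simp only [Polynomial.eval_add, Polynomial.eval_mul, Polynomial.eval_C, Polynomial.eval_X,
    Polynomial.eval_ofNat, size_prod x, size_cons]
  refine ⟨by nlinarith, fun M A B => ?_⟩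
  have h₁ := Does.dip x.1 A fun A => does_pop_m .bra (encTail x.2 ++ M) A B
  have h₂ := does_push .m .bra ⟨enc x.1 ++ (encTail x.2 ++ M), A, B⟩
  refine (((h₁.seq h₂).mono ?_).congr_left ?_).congr_right ?_
  · nlinarith
  · simp [enc, encTail, encList]
  · simp [enc_list, Mem.set, Mem.get]

theorem Poly.tail : Poly (fun l : List α => l.tail) := by
  refine ⟨.seq (pop .m) (.seq (ifTop .m (· ≠ some .ket) (drop α) skip) (push .m .bra)),
    Polynomial.C (cost α + 3) * .X + 10, fun l => ?_⟩
  simp only [Polynomial.eval_add, Polynomial.eval_mul, Polynomial.eval_C, Polynomial.eval_X,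
    Polynomial.eval_ofNat]
  cases l with
  | nil =>
    refine ⟨by simp only [List.tail, size_nil]; omega, fun M A B => ?_⟩
    have h₁ := does_pop_m .bra (.ket :: M) A B
    have h₂ := (does_skip ⟨.ket :: M, A, B⟩).ifTop_false (k := .m) (p := (· ≠ some .ket))
      (c := drop α) rfl
    exact (h₁.seq (h₂.seq (does_push .m .bra _))).mono (by omega)
  | cons x l =>
    refine ⟨by simp only [List.tail, size_cons]; nlinarith, fun M A B => ?_⟩
    have h₁ := does_pop_m .bra (enc x ++ (encTail l ++ M)) A B
    have h₂ := (does_drop x (encTail l ++ M) A B).ifTop_true (k := .m) (p := (· ≠ some .ket))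
      (d := skip) (head?_enc_append_ne x _)
    refine ((h₁.seq (h₂.seq (does_push .m .bra _))).mono ?_).congr_left ?_
    · simp only [size_cons]; nlinarith
    · simp [enc_list]

theorem Poly.headD (d : α) : Poly (fun l : List α => l.headD d) := by
  refine ⟨.seq (pop .m) (ifTop .m (· ≠ some .ket)
    -- A fresh opening bracket turns what follows the head into the code of a list, which `drop` can
    -- delete.
    (dip α (.seq (push .m .bra) (drop (List α)))) (.seq (pop .m) (pushWord .m (enc d)))),
    Polynomial.C (cost α + cost (List α) + 7) * .X + Polynomial.C (size d) + 20, fun l => ?_⟩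
  simp only [Polynomial.eval_add, Polynomial.eval_mul, Polynomial.eval_C, Polynomial.eval_X,
    Polynomial.eval_ofNat]
  cases l with
  | nil =>
    refine ⟨by simp only [List.headD_nil]; omega, fun M A B => ?_⟩
    have h₁ := does_pop_m .bra (.ket :: M) A B
    have h₂ := ((does_pop_m .ket M A B).seq (does_pushWord (enc d) M A B)).ifTop_false (k := .m)
      (p := (· ≠ some .ket)) (c := dip α (.seq (push .m .bra) (drop (List α)))) rfl
    exact (h₁.seq h₂).mono (by simp only [size]; omega)
  | cons x l =>
    refine ⟨by simp only [List.headD_cons, size_cons]; nlinarith, fun M A B => ?_⟩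
    have h₁ := does_pop_m .bra (enc x ++ (encTail l ++ M)) A B
    have h₂ := (Does.dip x A fun A => (does_push .m .bra ⟨encTail l ++ M, A, B⟩).seq
      (does_drop l M A B)).ifTop_true (k := .m) (p := (· ≠ some .ket))
      (d := .seq (pop .m) (pushWord .m (enc d))) (head?_enc_append_ne x _)
    refine ((h₁.seq h₂).mono ?_).congr_left ?_
    · simp only [size_cons]; nlinarith
    · simp [enc_list]

/-- Folding a polynomial-time step over a list, if the intermediate results stay small. -/
theorem Poly.foldlCore {f : β × α → β} (hf : Poly f) {D : Set (β × List α)} (Q : Polynomial ℕ)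
    (hQ : ∀ x ∈ D, ∀ l, l <+: x.2 →
      size (l.foldl (fun s a => f (s, a)) x.1) ≤ Q.eval (size x)) :
    ∃ (c : Cmd) (P : Polynomial ℕ), ∀ x ∈ D,
      size (x.2.foldl (fun s a => f (s, a)) x.1) ≤ P.eval (size x) ∧
      ∀ M A B, Does c (P.eval (size x)) ⟨enc x ++ M, A, B⟩
        ⟨enc (x.2.foldl (fun s a => f (s, a)) x.1) ++ M, A, B⟩ := by
  obtain ⟨c, P, hc⟩ := hf
  -- The state waits on `a` while the rest of the list is on `m`. `N` bounds the sizes of the states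
  -- and `T` that of the list. The number of rounds is at most the length of the remaining code,
  -- since no member has an empty code.
  have loop : ∀ (N T : ℕ) (M A B : List Γ') (l : List α) (s : β),
      (∀ l', l' <+: l → size (l'.foldl (fun s a => f (s, a)) s) ≤ N) → size l ≤ T →
      Does (whileTop .m (· ≠ some .ket) (.seq unstash (.seq c (stash β))))
        (((cost β + 4) * N + P.eval (N + T) + 6) * (encTail l).length)
        ⟨encTail l ++ M, (enc s).reverse ++ .blank :: A, B⟩
        ⟨.ket :: M, (enc (l.foldl (fun s a => f (s, a)) s)).reverse ++ .blank :: A, B⟩ := by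
    intro N T M A B l
    induction l with
    | nil =>
      intro s _ _
      refine (does_whileTop_stop rfl).mono ?_
      simp
    | cons x l ih =>
      intro s hN hT
      have hs : size s ≤ N := hN [] (by simp)
      have hs' : size (f (s, x)) ≤ N := hN [x] (by simp)
      have hx : size x ≤ T := (by rw [size_cons] at hT; omega)
      have hP : P.eval (size (s, x)) ≤ P.eval (N + T) :=
        eval_le_eval P (by rw [size_prod]; exact add_le_add hs hx)
      have h₁ := does_unstash s (enc x ++ (encTail l ++ M)) A B
      have h₂ := (hc (s, x)).2 (encTail l ++ M) A B
      have h₃ := does_stash (f (s, x)) (encTail l ++ M) A B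
      have h₄ := ih (f (s, x)) (fun l' hl => hN (x :: l') (by simpa using hl))
        (by rw [size_cons] at hT; omega)
      -- The state put back above the next member is already the code of the pair that `c` expects.
      have h₅ := h₁.seq ((h₂.congr_left (by simp [enc])).seq h₃)
      have h₆ := h₅.whileTop (k := .m) (p := (· ≠ some .ket)) (head?_enc_append_ne x _) h₄
      refine (h₆.mono ?_).congr_left (by simp)
      have hp := size_pos x
      rw [encTail_cons, List.length_append]
      have e₁ : (cost β) * size (f (s, x)) ≤ cost β * N := Nat.mul_le_mul_left _ hs'
      have e₂ : ∀ K : ℕ, K * (1 + (encTail l).length) ≤ K * ((enc x).length + (encTail l).length) :=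
        fun K => Nat.mul_le_mul_left K (Nat.add_le_add_right hp _)
      refine le_trans ?_ (e₂ _)
      rw [mul_add, mul_one, add_mul (cost β) 4 N]
      omega
  refine ⟨.seq (dip β (pop .m)) (.seq (stash β) (.seq
    (whileTop .m (· ≠ some .ket) (.seq unstash (.seq c (stash β)))) (.seq (pop .m) unstash))),
    Polynomial.C (2 * cost β + 20) * .X + Polynomial.C 4 * Q + 20 +
      (Polynomial.C (cost β + 4) * Q + P.comp (Q + .X) + 6) * .X, fun x hx => ?_⟩
  have hfin := hQ x hx x.2 (List.prefix_refl _)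
  have hbe := size_prod x
  simp only [Polynomial.eval_add, Polynomial.eval_mul, Polynomial.eval_C, Polynomial.eval_X,
    Polynomial.eval_ofNat, Polynomial.eval_comp]
  refine ⟨hfin.trans (by omega), fun M A B => ?_⟩
  have h₁ := Does.dip x.1 A fun A => does_pop_m .bra (encTail x.2 ++ M) A B
  have h₂ := does_stash x.1 (encTail x.2 ++ M) A B
  have h₃ := loop _ _ M A B x.2 x.1 (hQ x hx) (show size x.2 ≤ size x by omega)
  have h₄ := does_pop_m .ket M
    ((enc (x.2.foldl (fun s a => f (s, a)) x.1)).reverse ++ .blank :: A) B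
  have h₅ := does_unstash (x.2.foldl (fun s a => f (s, a)) x.1) M A B
  refine ((h₁.seq (h₂.seq (h₃.seq (h₄.seq h₅)))).mono ?_).congr_left
    (by simp [enc, encTail, encList])
  have e₁ : (encTail x.2).length ≤ size x := by rw [size_prod, size_list]; omega
  have e₂ := Nat.mul_le_mul_left
    ((cost β + 4) * Q.eval (size x) + P.eval (Q.eval (size x) + size x) + 6) e₁
  have e₃ : cost β * size x.1 ≤ cost β * size x := Nat.mul_le_mul_left _ (by omega)
  have e₄ : (2 * cost β + 20) * size x = 2 * (cost β * size x) + 20 * size x := by ring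
  rw [e₄, add_mul (cost β) 4 (size x.1)]
  omega

end

/-! ### Derived combinators -/

theorem foldl_pair {α β γ : Type} (f : γ × (β × α) → β) (x : γ) (l : List α) (b : β) :
    l.foldl (fun (s : γ × β) a => (s.1, f (s.1, (s.2, a)))) (x, b) =
      (x, l.foldl (fun b a => f (x, (b, a))) b) := by
  induction l generalizing b with
  | nil => rfl
  | cons a l ih => exact ih _

/-- Pair the members of two lists, completing the second one by `d`. -/
def zipD {α β : Type} (d : β) : List α → List β → List (α × β)
  | [], _ => []
  | a :: l, l' => (a, l'.headD d) :: zipD d l l'.tail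

theorem zipD_eq_zip {α β : Type} (d : β) {l : List α} {l' : List β} (h : l.length = l'.length) :
    zipD d l l' = l.zip l' := by
  induction l generalizing l' with
  | nil => rfl
  | cons a l ih =>
    cases l' with
    | nil => simp at h
    | cons b l' => simp [zipD, ih (by simpa using h)]

section

variable {α β γ δ : Type} [Item α] [Item β] [Item γ] [Item δ]

theorem Poly.assoc : Poly (fun x : (α × β) × γ => (x.1.1, (x.1.2, x.2))) :=
  .of_enc_eq fun x => by simp [enc]

/-- Folding a polynomial-time step over a list, if the intermediate results stay small. -/
theorem Poly.foldl {l : γ → List α} {s : γ → β} {f : γ × (β × α) → β} (hl : Poly l) (hs : Poly s)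
    (hf : Poly f) (Q : Polynomial ℕ)
    (hQ : ∀ x l', l' <+: l x →
      size (l'.foldl (fun b a => f (x, (b, a))) (s x)) ≤ Q.eval (size x)) :
    Poly (fun x => (l x).foldl (fun b a => f (x, (b, a))) (s x)) := by
  have hstep : Poly (fun y : (γ × β) × α => (y.1.1, f (y.1.1, (y.1.2, y.2)))) :=
    (Poly.fst.comp .fst).pair (hf.comp .assoc)
  -- The parameter `x` travels inside the accumulator, which accounts for `.X`. The size bound is
  -- known only for starting states built from some `x`, hence the restriction to `D`.
  obtain ⟨c, P, hc⟩ := hstep.foldlCore (D := {y | ∃ x, y = ((x, s x), l x)}) (Q + .X) (by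
    rintro _ ⟨x, rfl⟩ l' hl'
    simp only [foldl_pair, Polynomial.eval_add, Polynomial.eval_X]
    have h₁ := hQ x l' hl'
    have h₂ := eval_le_eval Q (show size x ≤ size ((x, s x), l x) by
      simp only [size_prod]; omega)
    rw [size_prod]
    exact add_comm (size x) _ ▸ add_le_add (h₁.trans h₂) (by simp only [size_prod]; omega))
  obtain ⟨d, R, hd⟩ := (Poly.id.pair hs).pair hl
  obtain ⟨e, S, he⟩ := Poly.snd (α := γ) (β := β)
  refine ⟨.seq d (.seq c e), R + P.comp R + (S.comp P).comp R, fun x => ?_⟩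
  have hcx := hc ((x, s x), l x) ⟨x, rfl⟩
  have h₁ := eval_le_eval P (hd x).1
  have h₂ := eval_le_eval S (hcx.1.trans h₁)
  simp only [foldl_pair, Polynomial.eval_add, Polynomial.eval_comp] at *
  have hex := he (x, (l x).foldl (fun b a => f (x, (b, a))) (s x))
  refine ⟨(hex.1.trans h₂).trans (by omega), fun M A B => ?_⟩
  exact (((hd x).2 M A B).seq ((hcx.2 M A B).seq (hex.2 M A B))).mono (by omega)

/-- Every member has size at least one, so `size l` bounds the number of steps. -/
theorem size_foldl_le {f : β → α → β} {K : ℕ} (l : List α) (b : β)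
    (hf : ∀ b, ∀ a ∈ l, size (f b a) ≤ size b + K) :
    size (l.foldl f b) ≤ size b + size l * K := by
  induction l generalizing b with
  | nil => simp
  | cons a l ih =>
    have h₁ := ih (f b a) fun b a ha => hf b a (List.mem_cons_of_mem _ ha)
    have h₂ := hf b a (by simp)
    have h₃ := Nat.mul_le_mul_right K (size_pos a)
    rw [size_cons, add_mul, List.foldl_cons]
    omega

theorem size_le_of_mem {l : List α} {a : α} (h : a ∈ l) : size a ≤ size l := by
  induction l with
  | nil => simp at h
  | cons b l ih =>
    rw [size_cons]
    rcases List.mem_cons.1 h with rfl | h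
    · omega
    · have := ih h; omega

theorem size_le_of_prefix {l l' : List α} (h : l' <+: l) : size l' ≤ size l := by
  obtain ⟨t, rfl⟩ := h
  have := size_append l' t
  have : 2 ≤ size t := by
    rw [size_list]
    simp only [encTail, List.length_append, List.length_singleton]
    omega
  omega

/-- Folding a polynomial-time step that increases the size by an amount that does not depend on
the intermediate result. -/
theorem Poly.foldl_of_add {l : γ → List α} {s : γ → β} {f : γ × (β × α) → β} (hl : Poly l)
    (hs : Poly s) (hf : Poly f) (R : Polynomial ℕ)
    (hR : ∀ x b a, size (f (x, (b, a))) ≤ size b + R.eval (size x + size a)) :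
    Poly (fun x => (l x).foldl (fun b a => f (x, (b, a))) (s x)) := by
  obtain ⟨_, L, hL⟩ := _root_.id hl
  obtain ⟨_, S, hS⟩ := _root_.id hs
  refine Poly.foldl hl hs hf (S + L * R.comp (.X + L)) fun x l' hl' => ?_
  have h := size_foldl_le (f := fun b a => f (x, (b, a))) (K := R.eval (size x + size (l x))) l'
    (s x) fun b a ha => (hR x b a).trans (Nat.add_le_add_left (eval_le_eval R
      (Nat.add_le_add_left (size_le_of_mem (hl'.subset ha)) _)) _)
  refine h.trans ?_
  simp only [Polynomial.eval_add, Polynomial.eval_mul, Polynomial.eval_comp, Polynomial.eval_X]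
  exact add_le_add (hS x).1 (Nat.mul_le_mul ((size_le_of_prefix hl').trans (hL x).1)
    (eval_le_eval R (Nat.add_le_add_left (hL x).1 _)))

theorem Poly.and {p q : α → Bool} (hp : Poly p) (hq : Poly q) : Poly (fun x => p x && q x) :=
  (Poly.ite hp hq (.const false)).of_eq fun x => by cases p x <;> simp

theorem Poly.or {p q : α → Bool} (hp : Poly p) (hq : Poly q) : Poly (fun x => p x || q x) :=
  (Poly.ite hp (.const true) hq).of_eq fun x => by cases p x <;> simp

theorem Poly.not {p : α → Bool} (hp : Poly p) : Poly (fun x => !p x) :=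
  (Poly.ite hp (.const false) (.const true)).of_eq fun x => by cases p x <;> simp

theorem Poly.beq [DecidableEq β] {f g : α → β} (hf : Poly f) (hg : Poly g) :
    Poly (fun x => decide (f x = g x)) :=
  Poly.eq.comp (hf.pair hg)

theorem size_bool (b : Bool) : size b = 1 := rfl

theorem Poly.all {l : γ → List α} {p : γ × α → Bool} (hl : Poly l) (hp : Poly p) :
    Poly (fun x => (l x).all fun a => p (x, a)) := by
  have hf : Poly (fun y : γ × (Bool × α) => y.2.1 && p (y.1, y.2.2)) :=
    (Poly.fst.comp .snd).and (hp.comp (Poly.fst.pair (Poly.snd.comp .snd)))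
  refine (Poly.foldl_of_add hl (.const true) hf 0 fun x b a => by simp [size_bool]).of_eq
    fun x => ?_
  have : ∀ (l : List α) b,
      l.foldl (fun b a => b && p (x, a)) b = (b && l.all fun a => p (x, a)) := by
    intro l
    induction l with
    | nil => simp
    | cons a l ih => intro b; simp [ih, Bool.and_assoc]
  simp [this]

theorem Poly.any {l : γ → List α} {p : γ × α → Bool} (hl : Poly l) (hp : Poly p) :
    Poly (fun x => (l x).any fun a => p (x, a)) :=
  (Poly.all hl hp.not).not.of_eq fun x => by simp [List.all_eq_not_any_not]

theorem Poly.revAppend : Poly (fun x : List α × List α => x.1.reverse ++ x.2) := by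
  refine (Poly.foldl_of_add (f := fun y : (List α × List α) × (List α × α) => y.2.2 :: y.2.1)
    .fst .snd (Poly.cons.comp ((Poly.snd.comp .snd).pair (Poly.fst.comp .snd))) .X
    fun x b a => ?_).of_eq fun x => ?_
  · simp only [size_cons, Polynomial.eval_X]; omega
  · simp

theorem Poly.reverse : Poly (fun l : List α => l.reverse) :=
  (Poly.revAppend.comp (Poly.id.pair (.const []))).of_eq fun x => by simp

theorem size_reverse (l : List α) : size l.reverse = size l := by
  induction l with
  | nil => rfl
  | cons a l ih =>
    have := size_append l.reverse [a]
    rw [size_cons, size_nil] at this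
    rw [List.reverse_cons, size_cons]
    omega

/-- The result is accumulated in reverse, so that each step only adds symbols in front of the
accumulator; one final reversal restores the order. -/
theorem Poly.flatMap {l : γ → List α} {f : γ × α → List β} (hl : Poly l) (hf : Poly f) :
    Poly (fun x => (l x).flatMap fun a => f (x, a)) := by
  obtain ⟨_, R, hR⟩ := _root_.id hf
  have hstep : Poly (fun y : γ × (List β × α) => (f (y.1, y.2.2)).reverse ++ y.2.1) :=
    Poly.revAppend.comp ((hf.comp (Poly.fst.pair (Poly.snd.comp .snd))).pair (Poly.fst.comp .snd))
  refine (Poly.reverse.comp (Poly.foldl_of_add hl (.const []) hstep R fun x b a => ?_)).of_eq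
    fun x => ?_
  · have h₁ := size_append (f (x, a)).reverse b
    have h₂ := (hR (x, a)).1
    rw [size_prod] at h₂
    rw [size_reverse] at h₁
    simp only at *
    omega
  · have : ∀ (l : List α) b, (l.foldl (fun b a => (f (x, a)).reverse ++ b) b).reverse =
        b.reverse ++ l.flatMap fun a => f (x, a) := by
      intro l
      induction l with
      | nil => simp
      | cons a l ih => intro b; rw [List.foldl_cons, ih]; simp
    rw [this]
    rfl

theorem Poly.singleton {f : α → β} (hf : Poly f) : Poly (fun x => [f x]) :=
  Poly.cons.comp (hf.pair (.const []))

theorem Poly.map {l : γ → List α} {f : γ × α → β} (hl : Poly l) (hf : Poly f) :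
    Poly (fun x => (l x).map fun a => f (x, a)) :=
  (Poly.flatMap hl hf.singleton).of_eq fun _ => List.flatMap_pure_eq_map _ _

theorem Poly.filter {l : γ → List α} {p : γ × α → Bool} (hl : Poly l) (hp : Poly p) :
    Poly (fun x => (l x).filter fun a => p (x, a)) :=
  (Poly.flatMap hl (Poly.ite hp (Poly.singleton .snd) (.const []))).of_eq fun x => by
    induction l x with
    | nil => rfl
    | cons a l ih => rw [List.flatMap_cons, ih, List.filter_cons]; split <;> rfl

theorem Poly.zipD (d : β) {f : γ → List α} {g : γ → List β} (hf : Poly f) (hg : Poly g) :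
    Poly (fun x => SemAc.zipD d (f x) (g x)) := by
  have hrest : Poly (fun y : γ × ((List (α × β) × List β) × α) => y.2.1.2) :=
    Poly.snd.comp (Poly.fst.comp .snd)
  have hstep : Poly (fun y : γ × ((List (α × β) × List β) × α) =>
      ((y.2.2, y.2.1.2.headD d) :: y.2.1.1, y.2.1.2.tail)) :=
    (Poly.cons.comp (((Poly.snd.comp .snd).pair ((Poly.headD d).comp hrest)).pair
      (Poly.fst.comp (Poly.fst.comp .snd)))).pair (Poly.tail.comp hrest)
  refine (Poly.reverse.comp (Poly.fst.comp (Poly.foldl_of_add hf ((Poly.const []).pair hg) hstep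
    (.X + Polynomial.C (size d)) fun x b a => ?_))).of_eq fun x => ?_
  · simp only [Polynomial.eval_add, Polynomial.eval_X, Polynomial.eval_C]
    rw [size_prod (_, _), size_cons, size_prod (_, _), size_prod b]
    simp only
    rcases b.2 with _ | ⟨c, l⟩
    · simp only [List.headD_nil, List.tail_nil]; omega
    · simp only [List.headD_cons, List.tail_cons, size_cons]; omega
  · have : ∀ (l : List α) (b : List (α × β) × List β),
        (l.foldl (fun b a => ((a, b.2.headD d) :: b.1, b.2.tail)) b).1.reverse =
          b.1.reverse ++ SemAc.zipD d l b.2 := by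
      intro l
      induction l with
      | nil => simp [SemAc.zipD]
      | cons a l ih =>
        intro b
        rw [List.foldl_cons, ih, List.reverse_cons, List.append_assoc]
        rfl
    rw [this]
    rfl

end

/-! ### The items of the evaluation problem -/

def QTerm.toPair : QTerm → Bool × ℕ
  | .const n => (false, n)
  | .var n => (true, n)

def Value.toPair : Value → Bool × ℕ
  | .const n => (false, n)
  | .null n => (true, n)

instance : Item QTerm := .ofInjective QTerm.toPair fun a b h => by
  cases a <;> cases b <;> simp_all [QTerm.toPair]

instance : Item Value := .ofInjective Value.toPair fun a b h => by
  cases a <;> cases b <;> simp_all [Value.toPair]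

instance {α : Type} [Item α] : Item (Atom α) :=
  .ofInjective (fun a => (a.rel, a.args)) fun a b h => by cases a; cases b; simpa using h

instance : Item TGD :=
  .ofInjective (fun τ => (τ.body, τ.head)) fun a b h => by cases a; cases b; simpa using h

instance : Item CQ :=
  .ofInjective (fun q => (q.free, q.body)) fun a b h => by cases a; cases b; simpa using h

instance : Item Input :=
  .ofInjective (fun x => (x.tgds, (x.query, (x.db, x.tuple)))) fun a b h => by
    cases a; cases b; simpa using h

theorem enc_qTerm : (enc : QTerm → List Γ') = encTerm := by
  funext t; cases t <;> rfl

theorem enc_value : (enc : Value → List Γ') = encValue := by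
  funext t; cases t <;> rfl

theorem enc_atom {α : Type} [Item α] : (enc : Atom α → List Γ') = encAtom enc := rfl

/-- This ties the item codes to the official encoding: the word given to the machine is literally an
item on its main stack. -/
theorem enc_input (x : Input) : enc x = encInput x := by
  have h₁ : (enc : Atom QTerm → List Γ') = encAtom encTerm := by rw [enc_atom, enc_qTerm]
  have h₂ : (enc : Atom Value → List Γ') = encAtom encValue := by rw [enc_atom, enc_value]
  have h₃ : (enc : TGD → List Γ') = encTGD := by
    funext τ
    change encList enc τ.body ++ encList enc τ.head = _
    rw [h₁]; rfl
  change encList enc x.tgds ++ ((encList encNat x.query.free ++ encList enc x.query.body) ++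
    (encList enc x.db ++ encList enc x.tuple)) = _
  rw [h₁, h₂, h₃, enc_value]
  rfl

/-! ### The consistency algorithm -/

noncomputable instance : DecidableEq QTerm := Classical.decEq _
noncomputable instance : DecidableEq Value := Classical.decEq _
noncomputable instance {α : Type} : DecidableEq (Atom α) := Classical.decEq _

/-- A finite partial assignment, as a list of pairs. -/
abbrev PAssign : Type := List (QTerm × Value)

/-- Equal terms get equal values. -/
noncomputable def compat (L L' : PAssign) : Bool :=
  L.all fun u => L'.all fun v => !decide (u.1 = v.1) || decide (u.2 = v.2)

theorem compat_iff {L L' : PAssign} :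
    compat L L' = true ↔ ∀ t v v', (t, v) ∈ L → (t, v') ∈ L' → v = v' := by
  simp only [compat, List.all_eq_true, Bool.or_eq_true, Bool.not_eq_true', decide_eq_false_iff_not,
    decide_eq_true_eq, Prod.forall]
  exact ⟨fun h t v v' h₁ h₂ => (h t v h₁ t v' h₂).resolve_left (fun h => h rfl),
    fun h t v h₁ t' v' h₂ => or_iff_not_imp_left.2 fun e => h t v v' h₁
      (not_not.1 e ▸ h₂)⟩

theorem poly_compat {α : Type} [Item α] {f g : α → PAssign} (hf : Poly f) (hg : Poly g) :
    Poly (fun x => compat (f x) (g x)) := by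
  have h₁ : Poly (fun y : ((PAssign × PAssign) × (QTerm × Value)) × (QTerm × Value) =>
      !decide (y.1.2.1 = y.2.1) || decide (y.1.2.2 = y.2.2)) :=
    ((Poly.fst.comp (Poly.snd.comp .fst)).beq (Poly.fst.comp .snd)).not.or
      ((Poly.snd.comp (Poly.snd.comp .fst)).beq (Poly.snd.comp .snd))
  have h₂ : Poly (fun y : PAssign × PAssign => compat y.1 y.2) :=
    Poly.all .fst (Poly.all (Poly.snd.comp .fst) h₁)
  exact h₂.comp (hf.pair hg)

/-- The value of a term when variables are read as nulls. -/
def QTerm.frozen : QTerm → Value := assign Value.null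

/-- Constants get themselves. -/
noncomputable def fixesConst (L : PAssign) : Bool :=
  -- The first component of `toPair` is true exactly for variables, on which no condition is
  -- imposed.
  L.all fun u => u.1.toPair.1 || decide (u.1.frozen = u.2)

theorem fixesConst_iff {L : PAssign} :
    fixesConst L = true ↔ ∀ c v, (QTerm.const c, v) ∈ L → v = .const c := by
  simp only [fixesConst, List.all_eq_true, Bool.or_eq_true, decide_eq_true_eq, Prod.forall]
  constructor
  · intro h c v hm
    simpa [QTerm.toPair, QTerm.frozen, assign, eq_comm] using h _ v hm
  · rintro h (c | y) v hm
    · exact .inr (h c v hm).symm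
    · exact .inl rfl

theorem poly_fixesConst : Poly fixesConst := by
  have h₁ : Poly QTerm.toPair := .of_enc_eq fun _ => rfl
  have h₂ : Poly QTerm.frozen := .of_enc_eq fun t => by cases t <;> rfl
  have h₃ : Poly (fun y : PAssign × (QTerm × Value) =>
      y.2.1.toPair.1 || decide (y.2.1.frozen = y.2.2)) :=
    (Poly.fst.comp (h₁.comp (Poly.fst.comp .snd))).or
      ((h₂.comp (Poly.fst.comp .snd)).beq (Poly.snd.comp .snd))
  exact Poly.all .id h₃

/-- Whether two lists have equal lengths. -/
def sameLength {α β : Type} (l : List α) (l' : List β) : Bool :=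
  decide ((l.map fun _ => true) = l'.map fun _ => true)

theorem sameLength_iff {α β : Type} {l : List α} {l' : List β} :
    sameLength l l' = true ↔ l.length = l'.length := by
  rw [sameLength, decide_eq_true_eq, List.map_const', List.map_const', List.replicate_inj]
  simp

theorem poly_sameLength {α β γ : Type} [Item α] [Item β] [Item γ] {f : γ → List α}
    {g : γ → List β} (hf : Poly f) (hg : Poly g) : Poly (fun x => sameLength (f x) (g x)) :=
  (Poly.map hf (.const true)).beq (Poly.map hg (.const true))

/-- The assignment of values to terms by position. -/
def matching (l : List QTerm) (l' : List Value) : PAssign := zipD (.const 0) l l'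

theorem poly_matching {α : Type} [Item α] {f : α → List QTerm} {g : α → List Value} (hf : Poly f)
    (hg : Poly g) : Poly (fun x => matching (f x) (g x)) :=
  Poly.zipD _ hf hg

/-- The assignment of the answer tuple to the free variables. -/
def Input.answer (x : Input) : PAssign := matching (x.query.free.map .var) x.tuple

/-- Whether the assignment is well defined. -/
noncomputable def Input.answerOk (x : Input) : Bool :=
  sameLength x.query.free x.tuple && compat x.answer x.answer

/-- Whether the match of the atom `a` with the fact `d` is well defined and agrees with `L`. -/
noncomputable def isMatch (L : PAssign) (a : Atom QTerm) (d : Atom Value) : Bool :=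
  (decide (a.rel = d.rel) && sameLength a.args d.args) &&
    (fixesConst (matching a.args d.args) &&
      (compat (matching a.args d.args) (matching a.args d.args) &&
        compat (matching a.args d.args) L))

/-- An atom of the query with an assignment of its terms. -/
abbrev Entry : Type := Atom QTerm × PAssign

/-- The matches of the atoms of the query. -/
noncomputable def Input.entries (x : Input) : List Entry :=
  x.query.body.flatMap fun a => x.db.flatMap fun d =>
    if isMatch x.answer a d then [(a, matching a.args d.args)] else []

/-- Keep the entries that can be extended to every atom. -/
noncomputable def refine (body : List (Atom QTerm)) (W : List Entry) : List Entry :=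
  W.filter fun e => body.all fun b => W.any fun e' => decide (e'.1 = b) && compat e.2 e'.2

/-- The list of entries also serves as the clock: a refinement that changes anything deletes an
entry, so this many rounds reach the fixed point. -/
noncomputable def Input.stable (x : Input) : List Entry :=
  x.entries.foldl (fun W _ => refine x.query.body W) x.entries

noncomputable def Input.accepts (x : Input) : Bool :=
  x.answerOk && x.query.body.all fun a => x.stable.any fun e => decide (e.1 = a)

/-! ### The consistency algorithm runs in polynomial time -/

section

variable {α : Type} [Item α]

theorem poly_free : Poly (fun x : Input => x.query.free) := by
  have h₁ : Poly (fun x : Input => (x.tgds, (x.query, (x.db, x.tuple)))) := .of_enc_eq fun _ => rfl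
  have h₂ : Poly (fun q : CQ => (q.free, q.body)) := .of_enc_eq fun _ => rfl
  exact Poly.fst.comp (h₂.comp (Poly.fst.comp (Poly.snd.comp h₁)))

theorem poly_body : Poly (fun x : Input => x.query.body) := by
  have h₁ : Poly (fun x : Input => (x.tgds, (x.query, (x.db, x.tuple)))) := .of_enc_eq fun _ => rfl
  have h₂ : Poly (fun q : CQ => (q.free, q.body)) := .of_enc_eq fun _ => rfl
  exact Poly.snd.comp (h₂.comp (Poly.fst.comp (Poly.snd.comp h₁)))

theorem poly_db : Poly (fun x : Input => x.db) := by
  have h₁ : Poly (fun x : Input => (x.tgds, (x.query, (x.db, x.tuple)))) := .of_enc_eq fun _ => rfl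
  exact Poly.fst.comp (Poly.snd.comp (Poly.snd.comp h₁))

theorem poly_tuple : Poly (fun x : Input => x.tuple) := by
  have h₁ : Poly (fun x : Input => (x.tgds, (x.query, (x.db, x.tuple)))) := .of_enc_eq fun _ => rfl
  exact Poly.snd.comp (Poly.snd.comp (Poly.snd.comp h₁))

theorem poly_answer : Poly Input.answer := by
  -- The constructor `QTerm.var` prefixes a tag to the code; pairing with that tag first leaves a
  -- map that does not change the code.
  have h₁ : Poly (fun p : Bool × ℕ => if p.1 then QTerm.var p.2 else QTerm.const p.2) :=
    .of_enc_eq fun p => by rcases p with ⟨_ | _, n⟩ <;> rfl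
  have h₂ : Poly QTerm.var := (h₁.comp ((Poly.const true).pair .id)).of_eq fun n => by simp
  exact poly_matching (Poly.map poly_free (h₂.comp .snd)) poly_tuple

theorem poly_answerOk : Poly Input.answerOk :=
  (poly_sameLength poly_free poly_tuple).and (poly_compat poly_answer poly_answer)

theorem poly_rel : Poly (fun a : Atom α => a.rel) := by
  have h : Poly (fun a : Atom α => (a.rel, a.args)) := .of_enc_eq fun _ => rfl
  exact Poly.fst.comp h

theorem poly_args : Poly (fun a : Atom α => a.args) := by
  have h : Poly (fun a : Atom α => (a.rel, a.args)) := .of_enc_eq fun _ => rfl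
  exact Poly.snd.comp h

theorem poly_isMatch {f : α → PAssign} {g : α → Atom QTerm} {h : α → Atom Value} (hf : Poly f)
    (hg : Poly g) (hh : Poly h) : Poly (fun x => isMatch (f x) (g x) (h x)) := by
  have ha := poly_args.comp hg
  have hd := poly_args.comp hh
  have hm := poly_matching ha hd
  exact (((poly_rel.comp hg).beq (poly_rel.comp hh)).and (poly_sameLength ha hd)).and
    ((poly_fixesConst.comp hm).and ((poly_compat hm hm).and (poly_compat hm hf)))

theorem poly_entries : Poly Input.entries := by
  have hx : Poly (fun y : (Input × Atom QTerm) × Atom Value => y.1.1) := Poly.fst.comp .fst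
  have ha : Poly (fun y : (Input × Atom QTerm) × Atom Value => y.1.2) := Poly.snd.comp .fst
  have h₁ : Poly (fun y : (Input × Atom QTerm) × Atom Value =>
      if isMatch y.1.1.answer y.1.2 y.2 then [(y.1.2, matching y.1.2.args y.2.args)] else []) :=
    Poly.ite (poly_isMatch (poly_answer.comp hx) ha .snd)
      (ha.pair (poly_matching (poly_args.comp ha) (poly_args.comp .snd))).singleton (.const [])
  exact Poly.flatMap poly_body (Poly.flatMap (poly_db.comp .fst) h₁)

theorem poly_refine {f : α → List (Atom QTerm)} {g : α → List Entry} (hf : Poly f) (hg : Poly g) :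
    Poly (fun x => refine (f x) (g x)) := by
  have h₁ : Poly (fun y : (((List (Atom QTerm) × List Entry) × Entry) × Atom QTerm) × Entry =>
      decide (y.2.1 = y.1.2) && compat y.1.1.2.2 y.2.2) :=
    ((Poly.fst.comp .snd).beq (Poly.snd.comp .fst)).and
      (poly_compat (Poly.snd.comp (Poly.snd.comp (Poly.fst.comp .fst))) (Poly.snd.comp .snd))
  have h₂ : Poly (fun y : List (Atom QTerm) × List Entry => refine y.1 y.2) :=
    Poly.filter .snd (Poly.all (Poly.fst.comp .fst)
      (Poly.any (Poly.snd.comp (Poly.fst.comp .fst)) h₁))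
  exact h₂.comp (hf.pair hg)

theorem size_filter_le (p : α → Bool) (l : List α) : size (l.filter p) ≤ size l := by
  induction l with
  | nil => exact le_rfl
  | cons a l ih =>
    rw [List.filter_cons]
    split <;> simp only [size_cons] <;> omega

theorem poly_stable : Poly Input.stable := by
  obtain ⟨_, P, hP⟩ := _root_.id poly_entries
  have hf : Poly (fun y : Input × (List Entry × Entry) => refine y.1.query.body y.2.1) :=
    poly_refine (poly_body.comp .fst) (Poly.fst.comp .snd)
  refine Poly.foldl poly_entries poly_entries hf P fun x l' _ => ?_
  -- Refinement only deletes entries, so every intermediate table is at most as large as the first.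
  have : ∀ (l : List Entry) (W : List Entry),
      size (l.foldl (fun W _ => refine x.query.body W) W) ≤ size W := by
    intro l
    induction l with
    | nil => exact fun _ => le_rfl
    | cons a l ih => exact fun W => (ih _).trans (size_filter_le _ _)
  exact (this l' _).trans (hP x).1

theorem poly_accepts : Poly Input.accepts := by
  have h₁ : Poly (fun y : (Input × Atom QTerm) × Entry => decide (y.2.1 = y.1.2)) :=
    (Poly.fst.comp .snd).beq (Poly.snd.comp .fst)
  exact poly_answerOk.and (Poly.all poly_body (Poly.any (poly_stable.comp .fst) h₁))

end

/-- The program is started with the input as its only stack content. The time bound `P + 1` leaves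
room for the step that writes the answer. -/
theorem Poly.promiseInPolyTime {promise yes : Input → Prop} {f : Input → Bool} (hf : Poly f)
    (h : ∀ x, promise x → (f x = true ↔ yes x)) :
    PromiseInPolyTime inputEncoding promise yes := by
  classical
  obtain ⟨c, P, hc⟩ := hf
  have key : ∀ x : {x // promise x}, Nonempty (TM2OutputsInTime (machine c) (encInput x.1)
      (some [decide (yes x.1)]) ((P + 1).eval (encInput x.1).length)) := by
    intro x
    obtain ⟨r, k, hk, hr⟩ := (hc x.1).2 [] [] [] (none, false)
    have hd : decide (yes x.1) = f x.1 := by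
      rw [Bool.eq_iff_iff, decide_eq_true_iff, h x.1 x.2]
    rw [hd]
    refine machine_outputs (k := (P + 1).eval (encInput x.1).length) (n := k) (r := r) ?_ ?_
    · rw [← enc_input]
      simpa [size] using hk
    · rw [enc_input, List.append_nil, List.append_nil] at hr
      exact hr
  exact ⟨{
    tm := machine c
    inputAlphabet := Equiv.refl Γ'
    outputAlphabet := Equiv.refl Bool
    time := P + 1
    outputsFun := fun x => by
      have := (key x).some
      have e : List.map (Equiv.refl Γ').invFun (encInput x.1) = encInput x.1 := List.map_id _
      exact e.symm ▸ this }⟩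

/-! ### Correctness of the fixed point -/

theorem mem_refine {body : List (Atom QTerm)} {W : List Entry} {e : Entry} :
    e ∈ refine body W ↔
      e ∈ W ∧ ∀ b ∈ body, ∃ e' ∈ W, e'.1 = b ∧ compat e.2 e'.2 = true := by
  simp [refine]

/-- A refinement is a filter: it either fixes the list or makes it strictly shorter. -/
theorem refine_iterate_eq (body : List (Atom QTerm)) : ∀ (n : ℕ) (W : List Entry),
    W.length ≤ n → refine body ((refine body)^[n] W) = (refine body)^[n] W := by
  intro n
  induction n with
  | zero =>
    intro W hW
    obtain rfl : W = [] := by simpa using hW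
    rfl
  | succ n ih =>
    intro W hW
    by_cases h : refine body W = W
    · rw [Function.iterate_fixed h, h]
    · rw [Function.iterate_succ_apply]
      refine ih _ ?_
      have h₁ : (refine body W).length ≤ W.length := List.length_filter_le _ _
      have h₂ : (refine body W).length ≠ W.length := fun e =>
        h (List.filter_sublist.eq_of_length e)
      omega

theorem foldl_const_eq_iterate {α β : Type} (f : β → β) (l : List α) (b : β) :
    l.foldl (fun b _ => f b) b = f^[l.length] b := by
  induction l generalizing b with
  | nil => rfl
  | cons a l ih => exact ih (f b)

theorem Input.stable_eq (x : Input) :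
    x.stable = (refine x.query.body)^[x.entries.length] x.entries :=
  foldl_const_eq_iterate _ _ _

theorem Input.exists_mem_stable {x : Input} {e : Entry} (he : e ∈ x.stable) {b : Atom QTerm}
    (hb : b ∈ x.query.body) : ∃ e' ∈ x.stable, e'.1 = b ∧ compat e.2 e'.2 = true := by
  rw [Input.stable_eq, ← refine_iterate_eq _ _ _ le_rfl, mem_refine] at he
  rw [Input.stable_eq]
  exact he.2 b hb

theorem refine_iterate_induction {body : List (Atom QTerm)} {p : List Entry → Prop}
    (hp : ∀ W, p W → p (refine body W)) (n : ℕ) {W : List Entry} (hW : p W) :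
    p ((refine body)^[n] W) := by
  induction n generalizing W with
  | zero => exact hW
  | succ n ih => exact ih (hp W hW)

theorem Input.mem_entries_of_mem_stable {x : Input} {e : Entry} (he : e ∈ x.stable) :
    e ∈ x.entries := by
  rw [Input.stable_eq] at he
  exact refine_iterate_induction (p := fun W => ∀ e ∈ W, e ∈ x.entries)
    (fun W h e he => h e (mem_refine.1 he).1) _ (fun _ h => h) e he

theorem Input.mem_entries {x : Input} {e : Entry} : e ∈ x.entries ↔ e.1 ∈ x.query.body ∧
    ∃ d ∈ x.db, isMatch x.answer e.1 d = true ∧ e.2 = matching e.1.args d.args := by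
  obtain ⟨a, L⟩ := e
  simp only [Input.entries, List.mem_flatMap]
  constructor
  · rintro ⟨b, hb, d, hd, h⟩
    split at h
    · obtain ⟨rfl, rfl⟩ : a = b ∧ L = matching b.args d.args := by simpa using h
      exact ⟨hb, d, hd, by assumption, rfl⟩
    · simp at h
  · rintro ⟨ha, d, hd, h, rfl⟩
    exact ⟨a, ha, d, hd, by simp [h]⟩

/-! ### Assignments read off from lists of pairs -/

open Classical in
/-- The assignment of the variables given by a list of pairs. -/
noncomputable def PAssign.val (L : PAssign) (n : ℕ) : Value :=
  if h : ∃ v, (QTerm.var n, v) ∈ L then h.choose else .const 0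

theorem assign_val {L : PAssign} (h : compat L L = true) (hc : fixesConst L = true) {t : QTerm}
    {v : Value} (hm : (t, v) ∈ L) : assign L.val t = v := by
  cases t with
  | const c => exact (fixesConst_iff.1 hc c v hm).symm
  | var n =>
    have hn : ∃ v, (QTerm.var n, v) ∈ L := ⟨v, hm⟩
    change L.val n = v
    rw [PAssign.val, dif_pos hn]
    exact compat_iff.1 h _ _ _ hn.choose_spec hm

theorem matching_eq_zip {l : List QTerm} {l' : List Value} (h : l.length = l'.length) :
    matching l l' = l.zip l' := zipD_eq_zip _ h

theorem map_eq_of_forall_mem_zip {α β : Type} {f : α → β} {l : List α} {l' : List β}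
    (hl : l.length = l'.length) (h : ∀ t v, (t, v) ∈ l.zip l' → f t = v) : l.map f = l' := by
  induction l generalizing l' with
  | nil => cases l' <;> simp_all
  | cons a l ih =>
    cases l' with
    | nil => simp at hl
    | cons b l' =>
      rw [List.map_cons, h a b (by simp), ih (by simpa using hl) fun t v hm => h t v (by simp [hm])]

theorem mem_zip_map {α β : Type} {f : α → β} {l : List α} {t : α} {v : β} :
    (t, v) ∈ l.zip (l.map f) ↔ t ∈ l ∧ v = f t := by
  induction l with
  | nil => simp
  | cons a l ih => simp [ih]; grind

theorem exists_mem_zip {α β : Type} {l : List α} {l' : List β} (hl : l.length = l'.length) {t : α}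
    (ht : t ∈ l) : ∃ v, (t, v) ∈ l.zip l' := by
  induction l generalizing l' with
  | nil => simp at ht
  | cons a l ih =>
    cases l' with
    | nil => simp at hl
    | cons b l' =>
      rcases List.mem_cons.1 ht with rfl | ht
      · exact ⟨b, by simp⟩
      · obtain ⟨v, hv⟩ := ih (by simpa using hl) ht
        exact ⟨v, by simp [hv]⟩

theorem mem_vars {a : Atom QTerm} {n : ℕ} : n ∈ a.vars ↔ QTerm.var n ∈ a.args := by
  simp only [Atom.vars, List.mem_flatMap]
  constructor
  · rintro ⟨t | t, ht, h⟩
    · simp [QTerm.vars] at h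
    · obtain rfl : n = t := by simpa [QTerm.vars] using h
      exact ht
  · exact fun h => ⟨_, h, by simp [QTerm.vars]⟩

theorem isMatch_iff {L : PAssign} {a : Atom QTerm} {d : Atom Value} :
    isMatch L a d = true ↔ a.rel = d.rel ∧ a.args.length = d.args.length ∧
      fixesConst (matching a.args d.args) = true ∧
      compat (matching a.args d.args) (matching a.args d.args) = true ∧
      compat (matching a.args d.args) L = true := by
  simp [isMatch, sameLength_iff, and_assoc]

/-- What an entry of the table says: its assignment maps the atom into the database. -/
theorem Input.map_mem_of_mem_entries {x : Input} {e : Entry} (he : e ∈ x.entries) :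
    e.1.map (assign e.2.val) ∈ x.inst ∧ compat e.2 x.answer = true ∧
      ∀ n ∈ e.1.vars, (QTerm.var n, e.2.val n) ∈ e.2 := by
  obtain ⟨-, d, hd, hm, he⟩ := Input.mem_entries.1 he
  obtain ⟨hr, hl, hc, h, hL⟩ := isMatch_iff.1 hm
  rw [← he] at hc h hL
  have hz := he.trans (matching_eq_zip hl)
  refine ⟨?_, hL, fun n hn => ?_⟩
  · have : e.1.map (assign e.2.val) = d := by
      have := map_eq_of_forall_mem_zip (f := assign e.2.val) hl fun t v hm =>
        assign_val h hc (by rw [hz]; exact hm)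
      cases d
      simp_all [Atom.map]
    rw [this]
    exact hd
  · obtain ⟨v, hv⟩ := exists_mem_zip hl (mem_vars.1 hn)
    rw [← hz] at hv
    have : e.2.val n = v := assign_val h hc hv
    rwa [this]

/-- The restrictions of one homomorphism to the atoms agree pairwise and with the answer, so each of
them supports all the others in every round. -/
theorem Input.accepts_of_yes {x : Input} (h : SemAcEvalYes x) : x.accepts = true := by
  obtain ⟨h, hh, ht⟩ := h
  have hmem : ∀ t v, (t, v) ∈ x.answer → v = assign h t := by
    intro t v hm
    rw [Input.answer, matching_eq_zip (by simp [← ht]), ← ht] at hm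
    have : x.query.free.map h = (x.query.free.map QTerm.var).map (assign h) := by
      simp [assign, Function.comp_def]
    rw [this, mem_zip_map] at hm
    exact hm.2
  let E : Atom QTerm → Entry := fun a => (a, matching a.args (a.map (assign h)).args)
  have hEm : ∀ a t v, (t, v) ∈ (E a).2 → v = assign h t := by
    intro a t v hm
    change (t, v) ∈ matching a.args (a.args.map (assign h)) at hm
    rw [matching_eq_zip (by simp)] at hm
    exact (mem_zip_map.1 hm).2
  have hcc : ∀ {L L' : PAssign}, (∀ t v, (t, v) ∈ L → v = assign h t) →
      (∀ t v, (t, v) ∈ L' → v = assign h t) → compat L L' = true := fun h₁ h₂ =>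
    compat_iff.2 fun t v v' h h' => (h₁ t v h).trans (h₂ t v' h').symm
  have hE₀ : ∀ a ∈ x.query.body, E a ∈ x.entries := fun a ha =>
    Input.mem_entries.2 ⟨ha, a.map (assign h), hh a ha, isMatch_iff.2 ⟨rfl, by simp [E, Atom.map],
      fixesConst_iff.2 fun c v hm => hEm a _ _ hm, hcc (hEm a) (hEm a), hcc (hEm a) hmem⟩, rfl⟩
  have hstable : ∀ a ∈ x.query.body, E a ∈ x.stable := by
    rw [Input.stable_eq]
    exact refine_iterate_induction (p := fun W => ∀ a ∈ x.query.body, E a ∈ W)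
      (fun W hW a ha => mem_refine.2 ⟨hW a ha, fun b hb => ⟨E b, hW b hb, rfl,
        hcc (hEm a) (hEm b)⟩⟩) _ hE₀
  simp only [Input.accepts, Input.answerOk, Bool.and_eq_true, sameLength_iff, List.all_eq_true,
    List.any_eq_true, decide_eq_true_eq]
  exact ⟨⟨by simp [← ht], hcc hmem hmem⟩, fun a ha => ⟨E a, hstable a ha, rfl⟩⟩

/-! ### Choices along a tree -/

section

variable {V X : Type} {T : SimpleGraph V} {S : V → X → Prop}

/-- Extend a choice along a walk, from its end to its start. -/
def walkChoice (ext : ∀ u v, T.Adj u v → {i // S u i} → {i // S v i}) {r : V} (i : {i // S r i}) :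
    ∀ {v}, T.Walk v r → {i // S v i}
  | _, .nil => i
  | _, .cons h p => ext _ _ h.symm (walkChoice ext i p)

/-- A choice at a root is propagated along the unique paths. The extension step relates a node to
its neighbour further from the root; symmetry of the relation covers the opposite orientation of an
edge. -/
theorem exists_choice_of_isTree (hT : T.IsTree) {R : V → V → X → X → Prop}
    (hsymm : ∀ u v i j, R u v i j → R v u j i) (hne : ∀ v, ∃ i, S v i)
    (hext : ∀ u v, T.Adj u v → ∀ i, S u i → ∃ j, S v j ∧ R u v i j) :
    ∃ c : V → X, (∀ v, S v (c v)) ∧ ∀ u v, T.Adj u v → R u v (c u) (c v) := by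
  obtain ⟨r⟩ := hT.connected.nonempty
  obtain ⟨i₀, h₀⟩ := hne r
  choose! e he using hext
  let ext : ∀ u v, T.Adj u v → {i // S u i} → {i // S v i} :=
    fun u v h i => ⟨e u v i, (he u v h i i.2).1⟩
  choose p hp _ using fun v => hT.existsUnique_path v r
  let f : ∀ v, T.Walk v r → {i // S v i} := fun v p => walkChoice ext ⟨i₀, h₀⟩ p
  have key : ∀ u v (h : T.Adj u v), p v = .cons h.symm (p u) →
      R u v (f u (p u)) (f v (p v)) := by
    intro u v h e
    rw [e]
    exact (he u v h _ (f u (p u)).2).2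
  refine ⟨fun v => f v (p v), fun v => (f v (p v)).2, fun u v h => ?_⟩
  -- By uniqueness of paths, one of two adjacent nodes has as its path to the root the edge followed
  -- by the path of the other.
  by_cases hv : v ∈ (p u).support
  · have := hT.isAcyclic.path_concat (hp v).reverse (hp u).reverse h.symm (by simpa using hv)
    exact hsymm _ _ _ _ (key v u h.symm (by simpa using congrArg SimpleGraph.Walk.reverse this))
  · refine key u v h ?_
    exact (hT.existsUnique_path v r).unique (hp v) ((hp u).cons hv)

end

/-! ### The product instance -/

section

variable {ι : Type} (code : ℕ ⊕ (Atom QTerm × (ι → Value)) → ℕ)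
  (dec : ℕ → ℕ ⊕ (Atom QTerm × (ι → Value))) (val : ι → ℕ → Value)

/-- The value at the index `i` of an element of the product instance. -/
def valueAt (i : ι) : Value → Value
  | .const c => .const c
  | .null n => match dec n with
    | .inl x => val i x
    | .inr p => p.2 i

/-- The elements that belong to the component of the atom `a`: constants, the variables of `a`, and
the functions labelled by `a`. -/
def InComp (a : Atom QTerm) : Value → Prop
  | .const _ => True
  | .null n => (∃ x ∈ a.vars, n = code (.inl x)) ∨ ∃ f, n = code (.inr (a, f))

/-- The instance glued from products, one for each atom of `body`, of the indices of that atom. -/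
def productInst (body : List (Atom QTerm)) (comp : ι → Atom QTerm) (D : Inst) : Inst :=
  {R | ∃ a ∈ body, (∀ v ∈ R.args, InComp code a v) ∧
    ∀ i, comp i = a → R.map (valueAt dec val i) ∈ D}

variable {code dec val}

theorem valueAt_inl (h : ∀ e, dec (code e) = e) (i : ι) (x : ℕ) :
    valueAt dec val i (.null (code (.inl x))) = val i x := by simp [valueAt, h]

theorem valueAt_inr (h : ∀ e, dec (code e) = e) (i : ι) (a : Atom QTerm) (f : ι → Value) :
    valueAt dec val i (.null (code (.inr (a, f)))) = f i := by simp [valueAt, h]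

/-- Two indices that agree on the common variables agree on the common elements. -/
theorem valueAt_eq_of_inComp (h : ∀ e, dec (code e) = e) {a b : Atom QTerm} {i j : ι}
    (hij : ∀ x ∈ a.vars, x ∈ b.vars → val i x = val j x) (hab : a = b → i = j) {v : Value}
    (ha : InComp code a v) (hb : InComp code b v) : valueAt dec val i v = valueAt dec val j v := by
  have hinj : Function.Injective code := Function.LeftInverse.injective h
  cases v with
  | const c => rfl
  | null n =>
    rcases ha with ⟨x, hx, rfl⟩ | ⟨f, rfl⟩
    · rcases hb with ⟨y, hy, hxy⟩ | ⟨g, hg⟩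
      · obtain rfl : x = y := by simpa using hinj hxy
        rw [valueAt_inl h, valueAt_inl h, hij x hx hy]
      · simpa using hinj hg
    -- A function element carries the label of its atom, so it lies in a single component.
    · rcases hb with ⟨y, hy, hxy⟩ | ⟨g, hg⟩
      · simpa using hinj hxy
      · obtain ⟨rfl, -⟩ : a = b ∧ f = g := by simpa using hinj hg
        rw [hab rfl]

theorem Atom.map_map {α β γ : Type} (g : β → γ) (f : α → β) (a : Atom α) :
    (a.map f).map g = a.map (g ∘ f) := by simp [Atom.map]

theorem Atom.map_congr {α β : Type} {f g : α → β} {a : Atom α} (h : ∀ x ∈ a.args, f x = g x) :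
    a.map f = a.map g := by
  simp only [Atom.map, Atom.mk.injEq, true_and]
  exact List.map_congr_left h

variable {body : List (Atom QTerm)} {comp : ι → Atom QTerm} {D : Inst}

/-- A fact of the product instance whose elements belong to the component of `a` holds at all
indices of `a`. -/
theorem map_valueAt_mem (h : ∀ e, dec (code e) = e)
    (hext : ∀ i, ∀ b ∈ body, ∃ j, comp j = b ∧
      ∀ x ∈ (comp i).vars, x ∈ b.vars → val i x = val j x)
    {R : Atom Value} (hR : R ∈ productInst code dec val body comp D) {i : ι}
    (ha : ∀ v ∈ R.args, InComp code (comp i) v) : R.map (valueAt dec val i) ∈ D := by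
  obtain ⟨b, hb, hRb, hD⟩ := hR
  by_cases hab : comp i = b
  · exact hD i hab
  -- The fact is witnessed in another component `b`. Its elements lie in both components, so
  -- projecting at `i` is the same as projecting at an index of `b` that agrees with `i`.
  · obtain ⟨j, hj, hij⟩ := hext i b hb
    rw [Atom.map_congr fun v hv =>
      valueAt_eq_of_inComp h hij (fun e => absurd e hab) (ha v hv) (hRb v hv)]
    exact hD j hj

theorem inComp_assign {a : Atom QTerm} {k : ℕ → Value} {R : Atom QTerm}
    (h : ∀ x ∈ R.vars, InComp code a (k x)) : ∀ v ∈ (R.map (assign k)).args, InComp code a v := by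
  intro v hv
  obtain ⟨t, ht, rfl⟩ := List.mem_map.1 hv
  cases t with
  | const c => trivial
  | var x => exact h x (mem_vars.2 ht)

theorem valueAt_comp_assign (i : ι) (k : ℕ → Value) :
    valueAt dec val i ∘ assign k = assign (valueAt dec val i ∘ k) := by
  funext t; cases t <;> rfl

theorem mem_conjVars {l : List (Atom QTerm)} {x : ℕ} : x ∈ conjVars l ↔ ∃ a ∈ l, x ∈ a.vars := by
  simp [conjVars]

-- This is where guardedness enters. The fact matched by the guard lies in one component and
-- contains the images of all body variables, so the whole body can be projected to each index of
-- that component.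
open Classical in
theorem models_productInst (h : ∀ e, dec (code e) = e)
    (hext : ∀ i, ∀ b ∈ body, ∃ j, comp j = b ∧
      ∀ x ∈ (comp i).vars, x ∈ b.vars → val i x = val j x)
    {S : Set TGD} (hS : S ∈ GuardedSets) (hD : Models D S) :
    Models (productInst code dec val body comp D) S := by
  rintro τ hτ _ ⟨k, hk, rfl⟩
  obtain ⟨g, hg, hgv⟩ := hS τ hτ
  obtain ⟨a, ha, hga, -⟩ := hk g hg
  have hvars : ∀ x ∈ conjVars τ.body, InComp code a (k x) := fun x hx =>
    hga (k x) (List.mem_map.2 ⟨.var x, mem_vars.1 (hgv x hx), rfl⟩)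
  have hloc : ∀ i, comp i = a → ∃ z : ℕ → Value, IsHom z τ.head D ∧
      τ.frontier.map z = τ.frontier.map (valueAt dec val i ∘ k) := by
    intro i hi
    refine hD τ hτ ⟨valueAt dec val i ∘ k, fun b hb => ?_, rfl⟩
    have := map_valueAt_mem h hext (hk b hb) (i := i) (inComp_assign fun x hx =>
      hi ▸ hvars x (mem_conjVars.2 ⟨b, hb, hx⟩))
    rwa [Atom.map_map, valueAt_comp_assign] at this
  have : Nonempty Value := ⟨.const 0⟩
  choose! z hz hzf using hloc
  -- An existential variable goes to the single product element whose coordinate at each index of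
  -- `a` is the witness found in `D` there. At other indices the coordinates do not matter.
  let k' : ℕ → Value := fun x =>
    if x ∈ τ.frontier then k x else .null (code (.inr (a, fun i => z i x)))
  have hk' : ∀ i, comp i = a → ∀ x, valueAt dec val i (k' x) = z i x := by
    intro i hi x
    by_cases hx : x ∈ τ.frontier
    · simp only [k', if_pos hx]
      exact (List.map_inj_left.1 (hzf i hi) x hx).symm
    · simp only [k', if_neg hx]
      exact valueAt_inr h i a _
  refine ⟨k', fun b hb => ⟨a, ha, inComp_assign fun x _ => ?_, fun i hi => ?_⟩,
    List.map_congr_left fun x hx => if_pos hx⟩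
  · by_cases hx : x ∈ τ.frontier
    · simp only [k', if_pos hx]
      exact hvars x (List.mem_filter.1 hx).1
    · simp only [k', if_neg hx]
      exact .inr ⟨_, rfl⟩
  · rw [Atom.map_map, valueAt_comp_assign]
    have : valueAt dec val i ∘ k' = z i := funext (hk' i hi)
    rw [this]
    exact hz i hi b hb

/-- The atoms of `body` are facts of the product instance. -/
theorem isHom_productInst (h : ∀ e, dec (code e) = e)
    (hval : ∀ i, (comp i).map (assign (val i)) ∈ D) :
    IsHom (fun x => .null (code (.inl x))) body (productInst code dec val body comp D) := by
  refine fun a ha => ⟨a, ha, inComp_assign fun x hx => .inl ⟨x, hx, rfl⟩, fun i hi => ?_⟩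
  subst hi
  rw [Atom.map_map, valueAt_comp_assign]
  have : valueAt dec val i ∘ (fun x => .null (code (.inl x))) = val i :=
    funext fun x => valueAt_inl h i x
  rw [this]
  exact hval i

theorem assign_null_injective : Function.Injective (assign Value.null) := by
  intro s t h
  cases s <;> cases t <;> simp_all [assign]

theorem null_mem_map_args {b : Atom QTerm} {y : ℕ} :
    Value.null y ∈ (b.map (assign Value.null)).args ↔ y ∈ b.vars := by
  rw [mem_vars, show Value.null y = assign Value.null (.var y) from rfl, Atom.map,
    List.mem_map_of_injective assign_null_injective]

open Classical in
/-- An acyclic query that maps to the product instance maps to the database, and each variable goes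
to a value of its image at some index. -/
theorem CQ.Acyclic.exists_isHom {q : CQ} (hq : q.Acyclic) (h : ∀ e, dec (code e) = e)
    (hext : ∀ i, ∀ b ∈ body, ∃ j, comp j = b ∧
      ∀ x ∈ (comp i).vars, x ∈ b.vars → val i x = val j x)
    (hcomp : ∀ b ∈ body, ∃ i, comp i = b) {k : ℕ → Value}
    (hk : IsHom k q.body (productInst code dec val body comp D)) :
    ∃ g : ℕ → Value, IsHom g q.body D ∧
      ∀ y ∈ conjVars q.body, ∃ i, InComp code (comp i) (k y) ∧ g y = valueAt dec val i (k y) := by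
  obtain ⟨V, T, lab, hT, hlab, hsurj, hconn⟩ := hq
  choose b hb hlb using hlab
  choose a ha hInt using fun v => hk (b v) (hb v)
  -- Each node of the join tree receives an index of its component; neighbouring indices are
  -- required to agree on all elements common to the two components.
  obtain ⟨c, hc, hR⟩ := exists_choice_of_isTree hT (S := fun v i => comp i = a v)
    (R := fun u v i j => ∀ w, InComp code (a u) w → InComp code (a v) w →
      valueAt dec val i w = valueAt dec val j w)
    (fun u v i j hr w hv hu => (hr w hu hv).symm) (fun v => hcomp _ (ha v))
    (fun u v _ i hi => by
      by_cases huv : a u = a v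
      · exact ⟨i, hi.trans huv, fun _ _ _ => rfl⟩
      · obtain ⟨j, hj, hij⟩ := hext i (a v) (ha v)
        exact ⟨j, hj, fun w hu hv =>
          valueAt_eq_of_inComp h (hi ▸ hij) (fun e => absurd e huv) hu hv⟩)
  have hin : ∀ v y, Value.null y ∈ (lab v).args → InComp code (a v) (k y) := by
    intro v y hy
    rw [hlb, null_mem_map_args, mem_vars] at hy
    exact (hInt v).1 (k y) (List.mem_map.2 ⟨_, hy, rfl⟩)
  -- The nodes containing `y` are connected, and along a walk through them the image of `y` stays in
  -- every component visited, so its projection does not change.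
  have hcons : ∀ y u v, Value.null y ∈ (lab u).args → Value.null y ∈ (lab v).args →
      valueAt dec val (c u) (k y) = valueAt dec val (c v) (k y) := by
    intro y u v hu hv
    have hpre := (hconn y ⟨lab u, ⟨b u, hb u, hlb u⟩, hu⟩).preconnected ⟨u, hu⟩ ⟨v, hv⟩
    obtain ⟨p⟩ := hpre
    have walk : ∀ (s t : {v | Value.null y ∈ (lab v).args}) (_ : (T.induce _).Walk s t),
        valueAt dec val (c s) (k y) = valueAt dec val (c t) (k y) := by
      intro s t p
      induction p with
      | nil => rfl
      | @cons s s' t hadj _ ih =>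
        exact (hR s s' hadj (k y) (hin s y s.2) (hin s' y s'.2)).trans ih
    exact walk _ _ p
  have hex : ∀ y ∈ conjVars q.body, ∃ v, Value.null y ∈ (lab v).args := by
    intro y hy
    obtain ⟨d, hd, hyd⟩ := mem_conjVars.1 hy
    obtain ⟨v, hv⟩ := hsurj _ ⟨d, hd, rfl⟩
    exact ⟨v, hv ▸ null_mem_map_args.2 hyd⟩
  have := hT.connected.nonempty
  choose! n hn using hex
  refine ⟨fun y => valueAt dec val (c (n y)) (k y), fun d hd => ?_, fun y hy =>
    ⟨c (n y), (hc (n y)).symm ▸ hin (n y) y (hn y hy), rfl⟩⟩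
  obtain ⟨v, hv⟩ := hsurj _ ⟨d, hd, rfl⟩
  have hmem : (d.map (assign k)).map (valueAt dec val (c v)) ∈ D :=
    map_valueAt_mem h hext (hk d hd) (inComp_assign fun x hx => (hc v).symm ▸
      hin v x (hv ▸ null_mem_map_args.2 hx))
  rw [Atom.map_map, valueAt_comp_assign] at hmem
  rw [Atom.map_congr (g := assign (valueAt dec val (c v) ∘ k))]
  · exact hmem
  · rintro (t | x) ht
    · rfl
    · have hx := mem_vars.2 ht
      exact hcons x _ _ (hn x (mem_conjVars.2 ⟨d, hd, hx⟩)) (hv ▸ null_mem_map_args.2 hx)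

end

/-! ### From local assignments to an answer -/

instance : Countable Value := by
  refine Function.Injective.countable (f := Value.toPair) fun a b h => ?_
  cases a <;> cases b <;> simp_all [Value.toPair]

instance : Countable (Atom QTerm) := (enc_injective (α := Atom QTerm)).countable

open Classical in
/-- If all atoms of a query that is semantically acyclic under guarded tgds can be mapped into a
model of the tgds, by local assignments each of which extends to every atom, then the query
holds. -/
theorem mem_eval_of_local {ι : Type} [Finite ι] {S : Set TGD} {q : CQ} {D : Inst}
    (hS : S ∈ GuardedSets) (hq : SemAcyclic S q) (hD : Models D S) {comp : ι → Atom QTerm}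
    {val : ι → ℕ → Value} {t : ℕ → Value} (hval : ∀ i, (comp i).map (assign (val i)) ∈ D)
    (hext : ∀ i, ∀ b ∈ q.body, ∃ j, comp j = b ∧
      ∀ x ∈ (comp i).vars, x ∈ b.vars → val i x = val j x)
    (hcomp : ∀ b ∈ q.body, ∃ i, comp i = b)
    (ht : ∀ i, ∀ x ∈ q.free, x ∈ (comp i).vars → val i x = t x) : q.free.map t ∈ q.eval D := by
  -- Finiteness of the index type makes the elements of the product countable, so nulls can name
  -- them.
  obtain ⟨code, hinj⟩ := exists_injective_nat (ℕ ⊕ (Atom QTerm × (ι → Value)))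
  obtain ⟨dec, hdec⟩ := hinj.hasLeftInverse
  obtain ⟨q', hq', hqq', hq'q⟩ := hq
  obtain ⟨k, hk, hkf⟩ := hqq' _ (models_productInst hdec hext hS hD)
    ⟨_, isHom_productInst hdec hval, rfl⟩
  obtain ⟨g, hg, hgv⟩ := hq'.exists_isHom hdec hext hcomp hk
  -- A free variable of `q'` need not occur in its body. Then `k` sends it to the element of the
  -- variable of `q` at the same position, and it takes the value of that variable under `t`. The
  -- other branches are arbitrary defaults.
  refine hq'q D hD ⟨fun y => if y ∈ conjVars q'.body then g y else match k y with
    | .const c => .const c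
    | .null n => match dec n with
      | .inl x => t x
      | .inr _ => .const 0, fun a ha => ?_, ?_⟩
  · rw [Atom.map_congr (g := assign g)]
    · exact hg a ha
    · rintro (s | x) hx
      · rfl
      · exact if_pos (mem_conjVars.2 ⟨a, ha, mem_vars.2 hx⟩)
  · have hlen : q'.free.length = q.free.length := by simpa using congrArg List.length hkf
    refine List.ext_getElem (by simpa using hlen) fun p h₁ h₂ => ?_
    rw [List.length_map] at h₁ h₂
    have hp : k q'.free[p] = .null (code (.inl q.free[p])) := by
      have := List.getElem_of_eq hkf (i := p) (by simpa using h₁)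
      rwa [List.getElem_map, List.getElem_map] at this
    simp only [List.getElem_map]
    split
    · rename_i hy
      obtain ⟨i, hi, hgi⟩ := hgv _ hy
      rw [hgi, hp, valueAt_inl hdec]
      rw [hp] at hi
      rcases hi with ⟨x, hx, hxe⟩ | ⟨f, hf⟩
      · obtain rfl : q.free[p] = x := by simpa using hinj hxe
        exact ht i _ (List.getElem_mem _) hx
      · simpa using hinj hf
    · rw [hp]
      simp only [hdec (.inl q.free[p])]

theorem Input.yes_of_accepts {x : Input} (hx : SemAcEvalPromise GuardedSets x)
    (h : x.accepts = true) : SemAcEvalYes x := by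
  obtain ⟨hS, hq, hD, -⟩ := hx
  simp only [Input.accepts, Input.answerOk, Bool.and_eq_true, sameLength_iff, List.all_eq_true,
    List.any_eq_true, decide_eq_true_eq] at h
  obtain ⟨⟨hlen, hans⟩, hall⟩ := h
  have hz : x.answer = (x.query.free.map QTerm.var).zip x.tuple :=
    matching_eq_zip (by simpa using hlen)
  have hfix : fixesConst x.answer = true := fixesConst_iff.2 fun c v hm => by
    rw [hz] at hm
    simpa using (List.of_mem_zip hm).1
  have ht : x.query.free.map x.answer.val = x.tuple := by
    have := map_eq_of_forall_mem_zip (f := assign x.answer.val)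
      (l := x.query.free.map QTerm.var) (l' := x.tuple) (by simpa using hlen)
      fun t v hm => assign_val hans hfix (hz ▸ hm)
    rw [← this, List.map_map]
    rfl
  have hfacts := fun e : {e // e ∈ x.stable} =>
    Input.map_mem_of_mem_entries (Input.mem_entries_of_mem_stable e.2)
  rw [SemAcEvalYes, ← ht]
  have : Finite {e // e ∈ x.stable} := List.finite_toSet _
  -- The surviving entries are the indices; the fixed-point property is exactly the extension
  -- condition.
  refine mem_eval_of_local hS hq hD (comp := fun e : {e // e ∈ x.stable} => e.1.1)
    (val := fun e => e.1.2.val) (fun e => (hfacts e).1) (fun e b hb => ?_) (fun b hb => ?_)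
    fun e n hn hv => ?_
  · obtain ⟨e', he', rfl, hc⟩ := Input.exists_mem_stable e.2 hb
    exact ⟨⟨e', he'⟩, rfl, fun n hn hn' =>
      compat_iff.1 hc _ _ _ ((hfacts e).2.2 n hn) ((hfacts ⟨e', he'⟩).2.2 n hn')⟩
  · obtain ⟨e, he, rfl⟩ := hall b hb
    exact ⟨⟨e, he⟩, rfl⟩
  · obtain ⟨v, hv'⟩ := exists_mem_zip (l := x.query.free.map QTerm.var) (l' := x.tuple)
      (by simpa using hlen) (List.mem_map_of_mem hn)
    rw [← hz] at hv'
    have h₁ : x.answer.val n = v := assign_val hans hfix hv'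
    rw [h₁]
    exact compat_iff.1 (hfacts e).2.1 _ _ _ ((hfacts e).2.2 n hv) hv'

end SemAc

theorem theorem21 :
    SemAc.PromiseInPolyTime SemAc.inputEncoding
      (SemAc.SemAcEvalPromise SemAc.GuardedSets) SemAc.SemAcEvalYes :=
  SemAc.poly_accepts.promiseInPolyTime fun _ hx =>
    ⟨SemAc.Input.yes_of_accepts hx, SemAc.Input.accepts_of_yes⟩
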